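/- Let $\alpha\in(0,2)$ and let $X_1,X_2,\ldots$ be i.i.d. real random variables whose common law is symmetric and regularly varying with index $\alpha$, i.e. $X_1\stackrel{d}{=}-X_1$ and $\mathbb P(|X_1|>x)=x^{-\alpha}L(x)$ for all $x>0$, where $L:(0,\infty)\to(0,\infty)$ satisfies $L(tx)/L(x)\to1$ as $x\to\infty$ for every $t>0$. Let $\mathbf y^{(n)}=(X_1,\ldots,X_n)^\top/\sqrt{X_1^2+\cdots+X_n^2}$ (with the value $0$, say, where the denominator vanishes). For $n\ge1$ let $\mathbf A_n=(a^{(n)}_{ij})_{i,j=1}^n$ be a random Hermitian $n\times n$ matrix independent of $\mathbf y^{(n)}$, all $\mathbf A_n$ being defined on one probability space, and put $$Q_{n,1}=(\mathbf y^{(n)})^\top \operatorname{diag}(\mathbf A_n)\,\mathbf y^{(n)} .$$ Assume that $\frac1n\sum_{i=1}^n\delta_{a^{(n)}_{ii}}$ converges weakly, almost surely, to a deterministic probability measure $\nu$ on $\mathbb R$, and that $$\lim_{T\to\infty}\limsup_{n\to\infty}\frac1n\sum_{i=1}^n|a^{(n)}_{ii}|\,\mathbf 1(|a^{(n)}_{ii}|>T)=0\qquad\text{almost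 surely.}$$ Let $K\subseteq\mathbb R$ be the convex hull of the support of $\nu$. Then for every $z\in\mathbb C\setminus K$ the functions $x\mapsto(z-x)^{\alpha/2-1}$ and $x\mapsto(z-x)^{\alpha/2}$ (principal branch) are $\nu$-integrable and $\int_{\mathbb R}(z-x)^{\alpha/2}\,\nu(dx)\neq0$. There is exactly one probability measure $\mu_{\nu,\alpha}$ on $\mathbb R$ whose Stieltjes transform is $$\int_{\mathbb R}\frac{1}{x-z}\,\mu_{\nu,\alpha}(dx)=-\frac{\int_{\mathbb R}(z-x)^{\alpha/2-1}\,\nu(dx)}{\int_{\mathbb R}(z-x)^{\alpha/2}\,\nu(dx)},\qquad z\in\mathbb C\setminus K ;$$ its support is contained in $K$, and $Q_{n,1}$ converges in distribution, as $n\to\infty$, to a random variable with law $\mu_{\nu,\alpha}$. -/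

import Mathlib

open MeasureTheory ProbabilityTheory Filter Topology
open scoped NNReal ENNReal

noncomputable section

namespace HeavyQuad

/-- `L : (0, ∞) → (0, ∞)` is slowly varying at infinity (values of `L` off `(0, ∞)` are
irrelevant). -/
def SlowlyVarying (L : ℝ → ℝ) : Prop :=
  (∀ x : ℝ, 0 < x → 0 < L x) ∧
    ∀ t : ℝ, 0 < t → Tendsto (fun x : ℝ => L (t * x) / L x) atTop (𝓝 1)

/-- `P(|ξ| > x) = x ^ (-α) * L x` for all `x > 0`, with `L` slowly varying. -/
def RegularlyVaryingTail {Ω : Type*} [MeasurableSpace Ω] (P : Measure Ω) (ξ : Ω → ℝ)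
    (α : ℝ) : Prop :=
  ∃ L : ℝ → ℝ, SlowlyVarying L ∧
    ∀ x : ℝ, 0 < x → P.real {ω | x < |ξ ω|} = x ^ (-α) * L x

/-- The self-normalized vector `x / ‖x‖₂` (equal to `0` if `x = 0`). -/
def selfNormalize {n : ℕ} (x : Fin n → ℝ) : Fin n → ℝ :=
  fun i => x i / Real.sqrt (∑ j, x j ^ 2)

/-- The vector `y = (X₀, …, X_{n-1}) / ‖(X₀, …, X_{n-1})‖₂`. -/
def selfNormalizedVector {Ω : Type*} (X : ℕ → Ω → ℝ) (n : ℕ) (ω : Ω) : Fin n → ℝ :=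
  selfNormalize fun i => X i ω

/-- Matrices carry the product sigma-algebra of their entries. -/
instance matrixMeasurableSpace (n : ℕ) : MeasurableSpace (Matrix (Fin n) (Fin n) ℂ) :=
  inferInstanceAs (MeasurableSpace (Fin n → Fin n → ℂ))

/-- The quadratic form `yᵀ B y` of a real vector and a complex matrix. -/
def quadForm {n : ℕ} (y : Fin n → ℝ) (B : Matrix (Fin n) (Fin n) ℂ) : ℂ :=
  (fun i => (y i : ℂ)) ⬝ᵥ B.mulVec (fun i => (y i : ℂ))

/-- The diagonal part `yᵀ diag(A) y` of the quadratic form `yᵀ A y`, as a real number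
(for Hermitian `A` it is real). -/
def diagQuadForm {n : ℕ} (y : Fin n → ℝ) (A : Matrix (Fin n) (Fin n) ℂ) : ℝ :=
  (quadForm y (Matrix.diagonal A.diag)).re

/-- The diagonal entries, as real numbers (for Hermitian `A` they are real). -/
def realDiag {n : ℕ} (A : Matrix (Fin n) (Fin n) ℂ) : Fin n → ℝ :=
  fun i => (A i i).re

/-- The empirical measure `n⁻¹ ∑ δ_{a i}`; a probability measure for `n ≥ 1`
and the zero measure for `n = 0`. -/
def empiricalMeasure {n : ℕ} (a : Fin n → ℝ) : FiniteMeasure ℝ :=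
  (n : ℝ≥0)⁻¹ • ∑ i, (diracProba (a i)).toFiniteMeasure

/-- `n⁻¹ ∑ |a i| 1(|a i| > T)`. -/
def tailAverage {n : ℕ} (a : Fin n → ℝ) (T : ℝ) : ℝ :=
  (n : ℝ)⁻¹ * ∑ i, Set.indicator {x : ℝ | T < |x|} (fun x => |x|) (a i)

/-- The Stieltjes transform `∫ 1 / (x - z) μ(dx)`. -/
def stieltjesTransform (μ : Measure ℝ) (z : ℂ) : ℂ :=
  ∫ x : ℝ, 1 / ((x : ℂ) - z) ∂μ

/-- The convex hull in `ℝ` of the support of `ν`, as a subset of the complex plane. -/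
def supportHull (ν : Measure ℝ) : Set ℂ :=
  (fun x : ℝ => (x : ℂ)) '' convexHull ℝ ν.support

/-- `∫ (z - x) ^ β ν(dx)`, with the principal branch of the power, cut along `(-∞, 0]`. -/
def powerIntegral (ν : Measure ℝ) (β : ℝ) (z : ℂ) : ℂ :=
  ∫ x : ℝ, (z - (x : ℂ)) ^ (β : ℂ) ∂ν

/-- `μ` has the Stieltjes transform
`- ∫ (z - x) ^ (α / 2 - 1) ν(dx) / ∫ (z - x) ^ (α / 2) ν(dx)`. -/
def HasLimitStieltjes (α : ℝ) (ν μ : Measure ℝ) : Prop :=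
  ∀ z : ℂ, z ∉ supportHull ν →
    stieltjesTransform μ z = -(powerIntegral ν (α / 2 - 1) z / powerIntegral ν (α / 2) z)

end HeavyQuad

end

/-! By independence the diagonal of the matrix can be frozen at a typical realization, so the
question concerns a deterministic array `a n i` with empirical limit `ν`. Put `β = α / 2 ∈ (0, 1)`.
The variables `V i = X i ^ 2` are nonnegative with regularly varying tail of index `-β`, and `Q = ∑
a i V i / ∑ V i`.

Suppose first that the `a i` are clipped to `[-T, T]`. For real `z > T` the quantity `W = z - Q` is
a ratio `R / S` of two positively weighted sums of the `V i`, with weights `z - a i` and `1`.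
Frullani's formula `log (R / S) = ∫ u⁻¹ (exp (-u S) - exp (-u R)) du` makes the expectation of the
logarithm depend only on the separate Laplace transforms of `R` and `S`, never on their joint law.
After a common rescaling these converge to `exp (-c u ^ β)` and `exp (-u ^ β)` with `c = ∫ (z - x) ^
β dν`, so `E log (z - Q)` tends to `β⁻¹ log c`. This is `tendsto_integral_log_ratio`.

Hence every subsequential limit `μ` satisfies `exp (β ∫ log (z - x) dμ) = ∫ (z - x) ^ β dν` on a
real half-line, and by the identity theorem on the plane cut along `(-∞, T]`. Differentiating gives
the Cauchy transform of `μ` as the ratio of the two power integrals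
(`cauchy_transform_clip_of_log`).

Clipping is removed in `L¹`: by exchangeability `E y_i ^ 2 ≤ 1 / n`, so replacing `a` by its clipped
version changes `Q` on average by at most the tail average, which uniform integrability makes small.
Tightness together with uniqueness in Stieltjes inversion turns convergence of Cauchy transforms
into convergence in law (`exists_limit_law`). The limit lives on the convex hull because `Q` is a
convex combination of the `a i`. The denominator does not vanish because the arguments of `z - x`
fill an interval of length at most `π`, which the power `β < 1` shrinks to less than a half-plane.
Since the limit law depends on `ν` and `α` only, averaging over the frozen diagonal finishes the
proof. -/

namespace HeavyQuad

/-! ### Regular variation: Potter's bound and dominated convergence -/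

/-- `G` is positive and regularly varying at infinity with index `-β`. -/
def RegVar (G : ℝ → ℝ) (β : ℝ) : Prop :=
  (∀ x : ℝ, 0 < x → 0 < G x) ∧
    ∀ u : ℝ, 0 < u → Tendsto (fun x : ℝ => G (u * x) / G x) atTop (𝓝 (u ^ (-β)))

/-- Since `2 ^ (-γ) < 2 ^ (-β)`, one doubling of a large argument costs at most a factor `2 ^ γ`.
Iterating about `log₂ (1 / u)` times gives `u ^ (-γ)`, and monotonicity covers the arguments between
powers of two. -/
theorem RegVar.potter {G : ℝ → ℝ} {β γ : ℝ} (hG : RegVar G β) (hβ0 : 0 < β) (hβγ : β < γ)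
    (hanti : Antitone G) :
    ∃ C x₀ : ℝ, 0 < C ∧ 0 < x₀ ∧
      ∀ x u : ℝ, x₀ ≤ x → 0 < u → u ≤ 1 → G (u * x) ≤ C * u ^ (-γ) * G x := by
  have hγ0 : 0 < γ := hβ0.trans hβγ
  obtain ⟨x₁, hx₁⟩ : ∃ x₁ : ℝ, ∀ x, x₁ ≤ x → G x ≤ 2 ^ γ * G (2 * x) := by
    have h := hG.2 2 two_pos
    have h2 : (2 : ℝ) ^ (-γ) < 2 ^ (-β) :=
      Real.rpow_lt_rpow_of_exponent_lt one_lt_two (by linarith)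
    have h3 := (h.eventually (lt_mem_nhds h2)).and (eventually_gt_atTop 0)
    obtain ⟨x₁, hx₁⟩ := eventually_atTop.1 h3
    refine ⟨x₁, fun x hx => ?_⟩
    obtain ⟨h4, h5⟩ := hx₁ x hx
    rw [lt_div_iff₀ (hG.1 x h5), Real.rpow_neg (by norm_num)] at h4
    have h6 : (0 : ℝ) < 2 ^ γ := by positivity
    rw [inv_mul_lt_iff₀ h6] at h4
    exact h4.le
  set x₀ := max x₁ 1 with hx₀
  have hx₀pos : 0 < x₀ := lt_max_of_lt_right one_pos
  have key : ∀ (k : ℕ) (y : ℝ), x₀ ≤ y → G y ≤ 2 ^ (γ * k) * G (2 ^ k * y) := by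
    intro k
    induction k with
    | zero => intro y _; simp
    | succ k ih =>
      intro y hy
      have hy0 : 0 < y := hx₀pos.trans_le hy
      have h1 := hx₁ y ((le_max_left _ _).trans hy)
      have h2 := ih (2 * y) (by linarith)
      calc G y ≤ 2 ^ γ * G (2 * y) := h1
        _ ≤ 2 ^ γ * (2 ^ (γ * k) * G (2 ^ k * (2 * y))) := by gcongr
        _ = 2 ^ (γ * (k + 1 : ℕ)) * G (2 ^ (k + 1) * y) := by
          rw [← mul_assoc, ← Real.rpow_add two_pos]
          congr 2
          · push_cast; ring
          · ring
  -- comparison for arguments that stay above the threshold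
  have above : ∀ x u : ℝ, 0 < u → u ≤ 1 → x₀ ≤ u * x → 0 < x →
      G (u * x) ≤ 2 ^ γ * u ^ (-γ) * G x := by
    intro x u hu hu1 hux hx
    -- `2 ^ k ≤ u⁻¹ < 2 ^ (k + 1)`: the `k + 1` doublings overshoot `x`, which is harmless for
    -- antitone `G` and costs the extra factor `2 ^ γ`.
    obtain ⟨k, hk1, hk2⟩ := exists_nat_pow_near (one_le_inv_iff₀.2 ⟨hu, hu1⟩) one_lt_two
    have h1 := key (k + 1) (u * x) hux
    have h2 : x ≤ 2 ^ (k + 1) * (u * x) := by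
      have : 1 ≤ 2 ^ (k + 1) * u := by
        have := mul_lt_mul_of_pos_right hk2 hu
        rw [inv_mul_cancel₀ hu.ne'] at this
        exact this.le
      nlinarith
    have h3 : (2 : ℝ) ^ (γ * (k + 1 : ℕ)) ≤ 2 ^ γ * u ^ (-γ) := by
      have : (2 : ℝ) ^ (γ * (k : ℕ)) ≤ u ^ (-γ) := by
        rw [mul_comm, Real.rpow_mul (by norm_num), Real.rpow_natCast, Real.rpow_neg hu.le,
          ← Real.inv_rpow hu.le]
        exact Real.rpow_le_rpow (by positivity) hk1 hγ0.le
      calc (2 : ℝ) ^ (γ * (k + 1 : ℕ)) = 2 ^ γ * 2 ^ (γ * (k : ℕ)) := by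
            rw [← Real.rpow_add two_pos]; congr 1; push_cast; ring
        _ ≤ _ := by gcongr
    calc G (u * x) ≤ 2 ^ (γ * (k + 1 : ℕ)) * G (2 ^ (k + 1) * (u * x)) := h1
      _ ≤ 2 ^ (γ * (k + 1 : ℕ)) * G x := by
          gcongr
          exact hanti h2
      _ ≤ 2 ^ γ * u ^ (-γ) * G x := by
          have := (hG.1 x hx).le
          gcongr
  -- Below the threshold only `G (u * x) ≤ G 0` is available; `D` converts this into a multiple of
  -- `G x₀`, after which the bound is applied with `x₀ / x > u` in place of `u`.
  set D : ℝ := max 1 (G 0 / G x₀) with hD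
  have hD1 : 1 ≤ D := le_max_left _ _
  refine ⟨D * 2 ^ γ, x₀, by positivity, hx₀pos, fun x u hx hu hu1 => ?_⟩
  have hx0 : 0 < x := hx₀pos.trans_le hx
  have hGx := hG.1 x hx0
  by_cases hux : x₀ ≤ u * x
  · refine (above x u hu hu1 hux hx0).trans ?_
    have : 0 ≤ 2 ^ γ * u ^ (-γ) * G x := by positivity
    nlinarith
  · push Not at hux
    have hv : 0 < x₀ / x := by positivity
    have h1 := above x (x₀ / x) hv ((div_le_one hx0).2 hx) (by rw [div_mul_cancel₀ _ hx0.ne']) hx0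
    rw [div_mul_cancel₀ _ hx0.ne'] at h1
    have h2 : (x₀ / x) ^ (-γ) ≤ u ^ (-γ) := by
      apply Real.rpow_le_rpow_of_nonpos hu _ (by linarith)
      rw [le_div_iff₀ hx0]; exact hux.le
    have h3 : G (u * x) ≤ D * G x₀ := by
      have h4 : G (u * x) ≤ G 0 := hanti (by positivity)
      have h5 := hG.1 x₀ hx₀pos
      have h6 : G 0 / G x₀ ≤ D := le_max_right _ _
      rw [div_le_iff₀ h5] at h6
      linarith
    calc G (u * x) ≤ D * G x₀ := h3
      _ ≤ D * (2 ^ γ * (x₀ / x) ^ (-γ) * G x) := by gcongr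
      _ ≤ D * (2 ^ γ * u ^ (-γ) * G x) := by gcongr
      _ = _ := by ring

theorem integrableOn_exp_mul_rpow {m s : ℝ} (hm : 0 < m) (hs : s < 1) :
    IntegrableOn (fun u : ℝ => Real.exp (-m * u) * u ^ (-s)) (Set.Ioi 0) := by
  have h := integrableOn_rpow_mul_exp_neg_mul_rpow (p := 1) (s := -s) (b := m) (by linarith)
    one_pos hm
  refine h.congr_fun (fun u hu => ?_) measurableSet_Ioi
  simp [mul_comm]

/-- Dominated convergence for rescaled regularly varying functions. -/
theorem RegVar.tendsto_integral {G : ℝ → ℝ} {β : ℝ} (hG : RegVar G β) (hβ0 : 0 < β)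
    (hβ1 : β < 1) (hanti : Antitone G) {x : ℕ → ℝ} (hx : Tendsto x atTop atTop)
    {k : ℕ → ℝ → ℝ} {k₀ : ℝ → ℝ} (hkm : ∀ n, Measurable (k n)) {m M : ℝ} (hm : 0 < m)
    (hbound : ∀ n u, 0 < u → |k n u| ≤ M * Real.exp (-m * u))
    (hlim : ∀ u, 0 < u → Tendsto (fun n => k n u) atTop (𝓝 (k₀ u))) :
    Tendsto (fun n => ∫ u in Set.Ioi 0, k n u * (G (u * x n) / G (x n))) atTop
      (𝓝 (∫ u in Set.Ioi 0, k₀ u * u ^ (-β))) := by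
  -- Any exponent `γ < 1` keeps the Potter majorant `u ^ (-γ)` integrable at `0`; for `u ≥ 1` the
  -- ratio of tails is at most `1`.
  obtain ⟨γ, hγ1, hγ2⟩ := exists_between hβ1
  obtain ⟨C, x₀, hC, hx₀, hpot⟩ := hG.potter hβ0 hγ1 hanti
  have hM : 0 ≤ M := by
    have := (abs_nonneg _).trans (hbound 0 1 one_pos)
    exact nonneg_of_mul_nonneg_left this (Real.exp_pos _)
  have hGm : Measurable G := hanti.measurable
  refine tendsto_integral_filter_of_dominated_convergence
    (fun u => M * C * (Real.exp (-m * u) * u ^ (-γ)) + M * (Real.exp (-m * u) * u ^ (-(0 : ℝ))))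
    (Eventually.of_forall fun n => ?_) ?_ ?_ ?_
  · exact ((hkm n).mul ((hGm.comp (measurable_id.mul_const _)).div_const _)).aestronglyMeasurable
  · filter_upwards [hx.eventually_ge_atTop x₀] with n hn
    filter_upwards [ae_restrict_mem measurableSet_Ioi] with u hu
    have hu : 0 < u := hu
    have hxn : 0 < x n := hx₀.trans_le hn
    have hG1 := hG.1 _ hxn
    have hG2 := hG.1 _ (mul_pos hu hxn)
    have h1 : G (u * x n) / G (x n) ≤ C * u ^ (-γ) + 1 := by
      rw [div_le_iff₀ hG1]
      rcases le_total u 1 with h | h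
      · have := hpot (x n) u hn hu h
        linarith
      · have h2 : G (u * x n) ≤ G (x n) := hanti (by nlinarith)
        have h3 : 0 ≤ C * u ^ (-γ) * G (x n) := by positivity
        linarith
    rw [Real.norm_eq_abs, abs_mul, abs_of_pos (div_pos hG2 hG1)]
    calc |k n u| * (G (u * x n) / G (x n))
        ≤ (M * Real.exp (-m * u)) * (C * u ^ (-γ) + 1) := by
          gcongr
          exact hbound n u hu
      _ = _ := by simp; ring
  · exact ((integrableOn_exp_mul_rpow hm hγ2).const_mul _).add
      ((integrableOn_exp_mul_rpow hm one_pos).const_mul _)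
  · filter_upwards [ae_restrict_mem measurableSet_Ioi] with u hu
    exact (hlim u hu).mul ((hG.2 u hu).comp hx)

/-! ### Laplace transforms of weighted heavy-tailed sums -/

/-- Layer-cake formula for the primitive `1 - exp (-l v)` of `l exp (-l u)`, applied to `s * V`.
Keeping `s` apart from `l` puts all weights at the common scale `s⁻¹`, so that their tails can be
compared with the single value at `s⁻¹`. -/
theorem integral_one_sub_exp_neg {Ω : Type*} [MeasurableSpace Ω] {P : Measure Ω}
    [IsProbabilityMeasure P] {V : Ω → ℝ} (hV : Measurable V) (hV0 : ∀ ω, 0 ≤ V ω)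
    {l s : ℝ} (hl : 0 < l) (hs : 0 < s) :
    ∫ ω, (1 - Real.exp (-(l * s * V ω))) ∂P =
      ∫ u in Set.Ioi 0, l * Real.exp (-l * u) * P.real {ω | u * s⁻¹ < V ω} := by
  have hprim : ∀ v : ℝ, ∫ u in (0 : ℝ)..v, l * Real.exp (-l * u) = 1 - Real.exp (-(l * v)) := by
    intro v
    have := intervalIntegral.integral_eq_sub_of_hasDerivAt (a := 0) (b := v)
      (f := fun u => - Real.exp (-l * u)) (f' := fun u => l * Real.exp (-l * u)) ?_ ?_
    · rw [this]; simp; ring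
    · intro u _
      have h1 : HasDerivAt (fun u : ℝ => -l * u) (-l) u := by
        simpa using (hasDerivAt_id u).const_mul (-l)
      convert! h1.exp.neg using 1
      ring
    · exact Continuous.intervalIntegrable (by fun_prop) _ _
  have h := lintegral_comp_eq_lintegral_meas_lt_mul (f := fun ω => s * V ω)
    (g := fun u => l * Real.exp (-l * u)) P
    (Eventually.of_forall fun ω => mul_nonneg hs.le (hV0 ω)) (hV.const_mul s).aemeasurable
    (fun t _ => Continuous.intervalIntegrable (by fun_prop) _ _)
    (Eventually.of_forall fun t => by positivity)
  simp only [hprim] at h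
  rw [integral_eq_lintegral_of_nonneg_ae, integral_eq_lintegral_of_nonneg_ae]
  · congr 1
    have h1 : ∀ ω, 1 - Real.exp (-(l * s * V ω)) = 1 - Real.exp (-(l * (s * V ω))) := by
      intro ω; rw [mul_assoc]
    simp only [h1, h]
    refine setLIntegral_congr_fun measurableSet_Ioi fun u hu => ?_
    have h2 : {ω | u * s⁻¹ < V ω} = {ω | u < s * V ω} := by
      ext ω
      simp only [Set.mem_ofPred_eq]
      rw [← div_eq_mul_inv, div_lt_iff₀ hs, mul_comm]
    simp only [h2]
    rw [ENNReal.ofReal_mul (p := l * Real.exp (-l * u)) (by positivity), ofReal_measureReal,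
      mul_comm]
  · exact Eventually.of_forall fun u => by positivity
  · refine Measurable.aestronglyMeasurable (Measurable.mul (by fun_prop) ?_)
    have : Antitone fun u : ℝ => P.real {ω | u * s⁻¹ < V ω} := by
      intro u v huv
      refine measureReal_mono fun ω hω => ?_
      exact lt_of_le_of_lt (mul_le_mul_of_nonneg_right huv (by positivity)) hω
    exact this.measurable
  · refine Eventually.of_forall fun ω => ?_
    have : Real.exp (-(l * s * V ω)) ≤ 1 := by
      have := hV0 ω
      rw [Real.exp_le_one_iff]
      have : 0 ≤ l * s * V ω := by positivity
      linarith
    simpa using this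
  · exact Measurable.aestronglyMeasurable (by fun_prop)

/-- The averages of bounded continuous functions along the rows of `a` converge to the
corresponding `ν`-integrals. -/
def WeakAvg (a : (n : ℕ) → Fin n → ℝ) (ν : Measure ℝ) : Prop :=
  ∀ f : ℝ → ℝ, Continuous f → (∃ C, ∀ x, |f x| ≤ C) →
    Tendsto (fun n : ℕ => (n : ℝ)⁻¹ * ∑ i, f (a n i)) atTop (𝓝 (∫ x, f x ∂ν))

theorem abs_avg_le {n : ℕ} {b : Fin n → ℝ} {C : ℝ} (hC : 0 ≤ C) (hb : ∀ i, |b i| ≤ C) :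
    |(n : ℝ)⁻¹ * ∑ i, b i| ≤ C := by
  rcases Nat.eq_zero_or_pos n with rfl | hn
  · simpa using hC
  have hn' : (0 : ℝ) < n := by exact_mod_cast hn
  rw [abs_mul, abs_of_pos (inv_pos.2 hn'), inv_mul_le_iff₀ hn']
  calc |∑ i, b i| ≤ ∑ i, |b i| := Finset.abs_sum_le_sum_abs _ _
    _ ≤ ∑ _i : Fin n, C := Finset.sum_le_sum fun i _ => hb i
    _ = n * C := by simp

theorem integral_mul_exp_neg_mul_rpow {l β : ℝ} (hl : 0 < l) (hβ1 : β < 1) :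
    ∫ u in Set.Ioi 0, l * Real.exp (-l * u) * u ^ (-β) = Real.Gamma (1 - β) * l ^ β := by
  have h := Real.integral_rpow_mul_exp_neg_mul_Ioi (a := 1 - β) (r := l) (by linarith) hl
  have h2 : ∀ u : ℝ, l * Real.exp (-l * u) * u ^ (-β) =
      l * (u ^ (1 - β - 1) * Real.exp (-(l * u))) := by
    intro u
    rw [show 1 - β - 1 = -β by ring, neg_mul]; ring
  simp only [h2]
  rw [integral_const_mul, h, one_div, Real.inv_rpow hl.le, Real.rpow_sub hl, Real.rpow_one]
  field_simp

theorem integral_laplace_average {ν : Measure ℝ} [IsProbabilityMeasure ν] {h : ℝ → ℝ}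
    (hh : Continuous h) {m M β : ℝ} (hm : 0 < m) (hmh : ∀ x, m ≤ h x) (hhM : ∀ x, h x ≤ M)
    (hβ1 : β < 1) :
    ∫ u in Set.Ioi 0, (∫ x, h x * Real.exp (-h x * u) ∂ν) * u ^ (-β) =
      Real.Gamma (1 - β) * ∫ x, h x ^ β ∂ν := by
  simp only [← integral_mul_const]
  rw [integral_integral_swap]
  · rw [← integral_const_mul]
    refine integral_congr_ae (Eventually.of_forall fun x => ?_)
    exact integral_mul_exp_neg_mul_rpow (hm.trans_le (hmh x)) hβ1
  · have hdom : Integrable (fun p : ℝ × ℝ => M * (Real.exp (-m * p.1) * p.1 ^ (-β)))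
        ((volume.restrict (Set.Ioi 0)).prod ν) := by
      have := ((integrableOn_exp_mul_rpow hm hβ1).const_mul M)
      exact this.comp_fst ν
    refine hdom.mono' ?_ ?_
    · refine Measurable.aestronglyMeasurable ?_
      have := hh.measurable
      unfold Function.uncurry
      fun_prop
    · have : ∀ᵐ p ∂((volume.restrict (Set.Ioi (0 : ℝ))).prod ν), 0 < p.1 :=
        Measure.quasiMeasurePreserving_fst.ae (ae_restrict_mem measurableSet_Ioi)
      filter_upwards [this] with p hp
      have h1 := hmh p.2
      have h2 := hhM p.2
      have h3 : 0 < h p.2 := hm.trans_le h1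
      have h4 : 0 ≤ p.1 ^ (-β) := by positivity
      have hM : 0 ≤ M := h3.le.trans h2
      simp only [Function.uncurry, norm_mul, Real.norm_eq_abs, abs_of_pos h3, Real.abs_exp,
        abs_of_nonneg h4]
      rw [mul_assoc]
      gcongr

theorem measurable_avg_laplace {n : ℕ} (c : Fin n → ℝ) :
    Measurable fun u : ℝ => (n : ℝ)⁻¹ * ∑ i, c i * Real.exp (-c i * u) := by
  fun_prop

theorem RegVar.antitone_tail {Ω : Type*} [MeasurableSpace Ω] (P : Measure Ω)
    [IsProbabilityMeasure P] (V : Ω → ℝ) : Antitone fun x : ℝ => P.real {ω | x < V ω} :=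
  fun _ _ hxy => measureReal_mono fun _ hω => lt_of_le_of_lt hxy hω

/-- The average over `i` is taken inside the `u`-integral. At fixed `u` it is the average of the
bounded continuous function `x ↦ h x * exp (-h x * u)`, so weak convergence is all that is needed;
the lower bound `m` gives an exponential majorant. -/
theorem RegVar.tendsto_avg_laplace {Ω : Type*} [MeasurableSpace Ω] {P : Measure Ω}
    [IsProbabilityMeasure P] {V : Ω → ℝ} (hV : Measurable V) (hV0 : ∀ ω, 0 ≤ V ω) {β : ℝ}
    (hG : RegVar (fun x => P.real {ω | x < V ω}) β) (hβ0 : 0 < β) (hβ1 : β < 1)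
    {a : (n : ℕ) → Fin n → ℝ} {ν : Measure ℝ} [IsProbabilityMeasure ν] (ha : WeakAvg a ν)
    {h : ℝ → ℝ} (hh : Continuous h) {m M : ℝ} (hm : 0 < m) (hmh : ∀ x, m ≤ h x)
    (hhM : ∀ x, h x ≤ M) {t : ℕ → ℝ} (ht0 : ∀ n, 0 < t n) (ht : Tendsto t atTop (𝓝 0)) :
    Tendsto (fun n : ℕ =>
        ((n : ℝ)⁻¹ * ∑ i, ∫ ω, (1 - Real.exp (-(h (a n i) * t n * V ω))) ∂P) /
          P.real {ω | (t n)⁻¹ < V ω})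
      atTop (𝓝 (Real.Gamma (1 - β) * ∫ x, h x ^ β ∂ν)) := by
  have hM : 0 < M := hm.trans_le ((hmh 0).trans (hhM 0))
  have hx : Tendsto (fun n => (t n)⁻¹) atTop atTop :=
    tendsto_inv_nhdsGT_zero.comp
      (tendsto_nhdsWithin_iff.2 ⟨ht, Eventually.of_forall ht0⟩)
  have hexp : ∀ x u : ℝ, 0 < u →
      |h x * Real.exp (-h x * u)| ≤ M * Real.exp (-m * u) := by
    intro x u hu
    have h1 := hmh x
    have h2 := hhM x
    have h3 : 0 < h x := hm.trans_le h1
    rw [abs_mul, abs_of_pos h3, Real.abs_exp]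
    gcongr
  have key := hG.tendsto_integral hβ0 hβ1 (RegVar.antitone_tail P V) hx
    (k := fun n u => (n : ℝ)⁻¹ * ∑ i, h (a n i) * Real.exp (-h (a n i) * u))
    (k₀ := fun u => ∫ x, h x * Real.exp (-h x * u) ∂ν)
    (fun n => measurable_avg_laplace _) (m := m) (M := M) hm
    (fun n u hu => abs_avg_le (by positivity) fun i => hexp _ u hu)
    (fun u hu => ha (fun x => h x * Real.exp (-h x * u)) (by fun_prop)
      ⟨M * Real.exp (-m * u), fun x => hexp x u hu⟩)
  rw [integral_laplace_average hh hm hmh hhM hβ1] at key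
  refine key.congr fun n => ?_
  simp only [← mul_div_assoc]
  rw [integral_div]
  congr 1
  have hint : ∀ i : Fin n, Integrable (fun u => h (a n i) * Real.exp (-h (a n i) * u) *
      P.real {ω | u * (t n)⁻¹ < V ω}) (volume.restrict (Set.Ioi 0)) := by
    intro i
    have hdom := (integrableOn_exp_mul_rpow hm (s := 0) one_pos).const_mul M
    refine hdom.mono' (Measurable.aestronglyMeasurable (Measurable.mul (by fun_prop) ?_)) ?_
    · exact (RegVar.antitone_tail P V).measurable.comp (measurable_id.mul_const _)
    · filter_upwards [ae_restrict_mem measurableSet_Ioi] with u hu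
      rw [norm_mul, Real.norm_eq_abs, Real.norm_eq_abs, abs_of_nonneg measureReal_nonneg]
      have := hexp (a n i) u hu
      have h2 : P.real {ω | u * (t n)⁻¹ < V ω} ≤ 1 := measureReal_le_one
      calc _ ≤ M * Real.exp (-m * u) * 1 := by gcongr
        _ = _ := by simp
  have : ∀ u : ℝ, ((n : ℝ)⁻¹ * ∑ i, h (a n i) * Real.exp (-h (a n i) * u)) *
      P.real {ω | u * (t n)⁻¹ < V ω} = (n : ℝ)⁻¹ * ∑ i, h (a n i) * Real.exp (-h (a n i) * u) *
      P.real {ω | u * (t n)⁻¹ < V ω} := by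
    intro u
    rw [mul_assoc, Finset.sum_mul]
  simp only [this]
  rw [integral_const_mul, integral_finsetSum _ fun i _ => hint i]
  congr 1
  refine Finset.sum_congr rfl fun i _ => ?_
  exact (integral_one_sub_exp_neg hV hV0 (hm.trans_le (hmh _)) (ht0 n)).symm

/-- Squeeze with `exp (-p / (1 - δ)) ≤ 1 - p ≤ exp (-p)`; the left inequality is `1 + x ≤ exp x` at
`x = p / (1 - p)`. -/
theorem tendsto_prod_one_sub {p : (n : ℕ) → Fin n → ℝ} {δ : ℕ → ℝ} {c : ℝ}
    (hp0 : ∀ n i, 0 ≤ p n i) (hpδ : ∀ n i, p n i ≤ δ n) (hδ : Tendsto δ atTop (𝓝 0))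
    (hsum : Tendsto (fun n => ∑ i, p n i) atTop (𝓝 c)) :
    Tendsto (fun n => ∏ i, (1 - p n i)) atTop (𝓝 (Real.exp (-c))) := by
  have hlow : Tendsto (fun n => Real.exp (-((∑ i, p n i) / (1 - δ n)))) atTop
      (𝓝 (Real.exp (-c))) := by
    have h1 : Tendsto (fun n => 1 - δ n) atTop (𝓝 1) := by
      simpa using hδ.const_sub 1
    have := (hsum.div h1 one_ne_zero).neg
    rw [div_one] at this
    exact (Real.continuous_exp.tendsto _).comp this
  have hup : Tendsto (fun n => Real.exp (-(∑ i, p n i))) atTop (𝓝 (Real.exp (-c))) :=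
    (Real.continuous_exp.tendsto _).comp hsum.neg
  refine tendsto_of_tendsto_of_tendsto_of_le_of_le' hlow hup ?_ ?_
  all_goals filter_upwards [hδ.eventually (gt_mem_nhds one_pos)] with n hn
  · rw [Finset.sum_div, ← Finset.sum_neg_distrib, Real.exp_sum]
    refine Finset.prod_le_prod (fun i _ => (Real.exp_pos _).le) fun i _ => ?_
    have h1 := hp0 n i
    have h2 := hpδ n i
    have h3 : 0 < 1 - p n i := by linarith
    have h4 : p n i / (1 - p n i) ≤ p n i / (1 - δ n) :=
      div_le_div_of_nonneg_left h1 (by linarith) (by linarith)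
    have h5 := Real.add_one_le_exp (p n i / (1 - p n i))
    have h6 : p n i / (1 - p n i) + 1 = (1 - p n i)⁻¹ := by field_simp; ring
    rw [h6] at h5
    calc Real.exp (-(p n i / (1 - δ n))) ≤ Real.exp (-(p n i / (1 - p n i))) := by
          gcongr
      _ = (Real.exp (p n i / (1 - p n i)))⁻¹ := Real.exp_neg _
      _ ≤ (1 - p n i) := by rw [inv_le_comm₀ (Real.exp_pos _) h3]; exact h5
  · rw [← Finset.sum_neg_distrib, Real.exp_sum]
    refine Finset.prod_le_prod (fun i _ => ?_) fun i _ => ?_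
    · have := hpδ n i
      linarith
    · have := Real.add_one_le_exp (-p n i)
      linarith

theorem integrable_one_sub_exp {Ω : Type*} [MeasurableSpace Ω] {P : Measure Ω}
    [IsProbabilityMeasure P] {V : Ω → ℝ} (hV : Measurable V) (hV0 : ∀ ω, 0 ≤ V ω) {l : ℝ}
    (hl : 0 ≤ l) : Integrable (fun ω => 1 - Real.exp (-(l * V ω))) P := by
  refine Integrable.of_bound (C := 1) (Measurable.aestronglyMeasurable (by fun_prop))
    (Eventually.of_forall fun ω => ?_)
  have h1 : Real.exp (-(l * V ω)) ≤ 1 := by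
    rw [Real.exp_le_one_iff]
    have := mul_nonneg hl (hV0 ω)
    linarith
  have h2 := Real.exp_pos (-(l * V ω))
  rw [Real.norm_eq_abs, abs_le]
  constructor <;> linarith

theorem integral_one_sub_exp_mono {Ω : Type*} [MeasurableSpace Ω] {P : Measure Ω}
    [IsProbabilityMeasure P] {V : Ω → ℝ} (hV : Measurable V) (hV0 : ∀ ω, 0 ≤ V ω) {l l' : ℝ}
    (hl : 0 ≤ l) (hll : l ≤ l') :
    ∫ ω, (1 - Real.exp (-(l * V ω))) ∂P ≤ ∫ ω, (1 - Real.exp (-(l' * V ω))) ∂P := by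
  refine integral_mono (integrable_one_sub_exp hV hV0 hl)
    (integrable_one_sub_exp hV hV0 (hl.trans hll)) fun ω => ?_
  have := mul_le_mul_of_nonneg_right hll (hV0 ω)
  simp only
  gcongr

theorem continuousOn_integral_one_sub_exp {Ω : Type*} [MeasurableSpace Ω] {P : Measure Ω}
    [IsProbabilityMeasure P] {V : Ω → ℝ} (hV : Measurable V) (hV0 : ∀ ω, 0 ≤ V ω) :
    ContinuousOn (fun l : ℝ => ∫ ω, (1 - Real.exp (-(l * V ω))) ∂P) (Set.Ici 0) := by
  refine continuousOn_of_dominated (bound := fun _ => 1) (fun l _ =>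
    Measurable.aestronglyMeasurable (by fun_prop)) (fun l hl => Eventually.of_forall fun ω => ?_)
    (integrable_const _) (Eventually.of_forall fun ω => Continuous.continuousOn (by fun_prop))
  have h1 : Real.exp (-(l * V ω)) ≤ 1 := by
    rw [Real.exp_le_one_iff]
    have := mul_nonneg (Set.mem_Ici.1 hl) (hV0 ω)
    linarith
  have h2 := Real.exp_pos (-(l * V ω))
  rw [Real.norm_eq_abs, abs_le]
  constructor <;> linarith

theorem integral_one_sub_exp_pos {Ω : Type*} [MeasurableSpace Ω] {P : Measure Ω}
    [IsProbabilityMeasure P] {V : Ω → ℝ} (hV : Measurable V) (hV0 : ∀ ω, 0 ≤ V ω)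
    (hpos : 0 < P.real {ω | 1 < V ω}) {l : ℝ} (hl : 0 < l) :
    0 < ∫ ω, (1 - Real.exp (-(l * V ω))) ∂P := by
  have hnn : ∀ ω, 0 ≤ 1 - Real.exp (-(l * V ω)) := fun ω => by
    have := mul_nonneg hl.le (hV0 ω)
    have : Real.exp (-(l * V ω)) ≤ 1 := Real.exp_le_one_iff.2 (by linarith)
    linarith
  rw [integral_pos_iff_support_of_nonneg hnn (integrable_one_sub_exp hV hV0 hl.le)]
  have h1 : 0 < P {ω | 1 < V ω} := (ENNReal.toReal_pos_iff.1 hpos).1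
  refine h1.trans_le (measure_mono fun ω hω => ?_)
  have hω : 1 < V ω := hω
  have h2 : 0 < l * V ω := by positivity
  have : Real.exp (-(l * V ω)) < 1 := Real.exp_zero ▸ Real.exp_lt_exp.2 (by linarith)
  simp only [Function.mem_support]
  linarith

/-- Defining the scale by the equation `E (1 - exp (-t V)) = 1 / n`, rather than by a quantile of
the tail, normalizes the limit of the unweighted sum to exactly `exp (-u ^ β)`. The intermediate
value theorem solves it once `1 / n` is below the value at `t = 1`. -/
theorem exists_laplace_scaling {Ω : Type*} [MeasurableSpace Ω] {P : Measure Ω}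
    [IsProbabilityMeasure P] {V : Ω → ℝ} (hV : Measurable V) (hV0 : ∀ ω, 0 ≤ V ω)
    (hpos : 0 < P.real {ω | 1 < V ω}) :
    ∃ t : ℕ → ℝ, (∀ n, 0 < t n) ∧ Tendsto t atTop (𝓝 0) ∧
      ∀ᶠ n : ℕ in atTop, n * ∫ ω, (1 - Real.exp (-(t n * V ω))) ∂P = 1 := by
  set ψ : ℝ → ℝ := fun l => ∫ ω, (1 - Real.exp (-(l * V ω))) ∂P with hψ
  have hψ0 : ψ 0 = 0 := by simp [hψ]
  have hψpos : ∀ l, 0 < l → 0 < ψ l := fun l hl => integral_one_sub_exp_pos hV hV0 hpos hl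
  -- The last two alternatives cover the finitely many `n` without a guaranteed solution, where `s =
  -- 1` is a dummy value.
  have hex : ∀ n : ℕ, ∃ s : ℝ, 0 < s ∧ (n * ψ s = 1 ∨ n = 0 ∨ (n : ℝ)⁻¹ > ψ 1) := by
    intro n
    by_cases hn : n = 0
    · exact ⟨1, one_pos, Or.inr (Or.inl hn)⟩
    by_cases hn2 : (n : ℝ)⁻¹ > ψ 1
    · exact ⟨1, one_pos, Or.inr (Or.inr hn2)⟩
    have hn' : (0 : ℝ) < n := by exact_mod_cast Nat.pos_of_ne_zero hn
    have hcont : ContinuousOn ψ (Set.Icc 0 1) :=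
      (continuousOn_integral_one_sub_exp hV hV0).mono fun x hx => hx.1
    obtain ⟨s, hs, hs2⟩ := intermediate_value_Icc zero_le_one hcont
      (show (n : ℝ)⁻¹ ∈ Set.Icc (ψ 0) (ψ 1) from
        ⟨by rw [hψ0]; positivity, not_lt.1 hn2⟩)
    refine ⟨s, lt_of_le_of_ne hs.1 ?_, Or.inl ?_⟩
    · rintro rfl
      rw [hψ0] at hs2
      exact (inv_pos.2 hn').ne hs2
    · rw [hs2, mul_inv_cancel₀ hn'.ne']
  choose t ht0 ht using hex
  have hev : ∀ᶠ n : ℕ in atTop, n * ψ (t n) = 1 := by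
    filter_upwards [eventually_gt_atTop 0,
      tendsto_inv_atTop_nhds_zero_nat.eventually (gt_mem_nhds (hψpos 1 one_pos))] with n h1 h2
    rcases ht n with h | h | h
    · exact h
    · omega
    · exact absurd h2 (not_lt.2 h.le)
  refine ⟨t, ht0, ?_, hev⟩
  rw [Metric.tendsto_nhds]
  intro ε hε
  filter_upwards [hev, eventually_gt_atTop 0,
    tendsto_inv_atTop_nhds_zero_nat.eventually (gt_mem_nhds (hψpos ε hε))] with n h1 h2 h3
  rw [Real.dist_eq, sub_zero, abs_of_pos (ht0 n)]
  by_contra! h4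
  have h5 : ψ ε ≤ ψ (t n) := integral_one_sub_exp_mono hV hV0 hε.le h4
  have h6 : ψ (t n) = (n : ℝ)⁻¹ := eq_inv_of_mul_eq_one_right h1
  linarith

theorem integral_exp_neg_sum {Ω : Type*} [MeasurableSpace Ω] {P : Measure Ω}
    [IsProbabilityMeasure P] {V : ℕ → Ω → ℝ} (hVm : ∀ j, Measurable (V j))
    (hVi : iIndepFun V P) (hVid : ∀ j, IdentDistrib (V j) (V 0) P P) {n : ℕ} (c : Fin n → ℝ) :
    ∫ ω, Real.exp (-∑ i : Fin n, c i * V i ω) ∂P =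
      ∏ i : Fin n, ∫ ω, Real.exp (-(c i * V 0 ω)) ∂P := by
  have h1 : iIndepFun (fun i : Fin n => V i) P := hVi.precomp Fin.val_injective
  have h2 := h1.integral_fun_prod_comp (f := fun i x => Real.exp (-(c i * x)))
    (fun i => (hVm i).aemeasurable)
    (fun i => (Measurable.aestronglyMeasurable (by fun_prop)))
  simp only [← Finset.sum_neg_distrib, Real.exp_sum]
  rw [h2]
  refine Finset.prod_congr rfl fun i _ => ?_
  exact ((hVid i).comp (u := fun x => Real.exp (-(c i * x))) (by fun_prop)).integral_eq

theorem tendsto_laplace_sum {Ω : Type*} [MeasurableSpace Ω] {P : Measure Ω}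
    [IsProbabilityMeasure P] {V : ℕ → Ω → ℝ} (hVm : ∀ j, Measurable (V j))
    (hVi : iIndepFun V P) (hVid : ∀ j, IdentDistrib (V j) (V 0) P P)
    (hV0 : ∀ ω, 0 ≤ V 0 ω) {β : ℝ} (hβ0 : 0 < β) (hβ1 : β < 1)
    (hG : RegVar (fun x => P.real {ω | x < V 0 ω}) β)
    {a : (n : ℕ) → Fin n → ℝ} {ν : Measure ℝ} [IsProbabilityMeasure ν] (ha : WeakAvg a ν)
    {h : ℝ → ℝ} (hh : Continuous h) {m M : ℝ} (hm : 0 < m) (hmh : ∀ x, m ≤ h x)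
    (hhM : ∀ x, h x ≤ M) {t : ℕ → ℝ} (ht0 : ∀ n, 0 < t n) (ht : Tendsto t atTop (𝓝 0))
    (htn : ∀ᶠ n : ℕ in atTop, n * ∫ ω, (1 - Real.exp (-(t n * V 0 ω))) ∂P = 1)
    {u : ℝ} (hu : 0 < u) :
    Tendsto (fun n : ℕ => ∫ ω, Real.exp (-(u * (t n * ∑ i : Fin n, h (a n i) * V i ω))) ∂P)
      atTop (𝓝 (Real.exp (-((∫ x, h x ^ β ∂ν) * u ^ β)))) := by
  have hM : 0 < M := hm.trans_le ((hmh 0).trans (hhM 0))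
  set ψ : ℝ → ℝ := fun l => ∫ ω, (1 - Real.exp (-(l * V 0 ω))) ∂P with hψ
  have hΓ : 0 < Real.Gamma (1 - β) := Real.Gamma_pos_of_pos (by linarith)
  have hA := hG.tendsto_avg_laplace (hVm 0) hV0 hβ0 hβ1 ha (h := fun x => u * h x)
    (by fun_prop) (m := u * m) (M := u * M) (by positivity)
    (fun x => mul_le_mul_of_nonneg_left (hmh x) hu.le)
    (fun x => mul_le_mul_of_nonneg_left (hhM x) hu.le) ht0 ht
  -- The same asymptotics with constant weight `1`. In the quotient of the two limits the tail at
  -- `(t n)⁻¹` and the factor `Γ(1 - β)` cancel, and the scaling equation makes the denominator sum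
  -- equal to `1`.
  have hB := hG.tendsto_avg_laplace (hVm 0) hV0 hβ0 hβ1 ha (h := fun _ => 1)
    (by fun_prop) (m := 1) (M := 1) one_pos (fun x => le_rfl) (fun x => le_rfl) ht0 ht
  simp only [Real.one_rpow, integral_const, probReal_univ, smul_eq_mul, mul_one, one_mul] at hB
  have hC := hA.div hB hΓ.ne'
  have hint : ∫ x, (u * h x) ^ β ∂ν = (∫ x, h x ^ β ∂ν) * u ^ β := by
    rw [← integral_mul_const]
    refine integral_congr_ae (Eventually.of_forall fun x => ?_)
    simp only
    rw [Real.mul_rpow hu.le (hm.le.trans (hmh x)), mul_comm]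
  rw [hint, mul_div_cancel_left₀ _ hΓ.ne'] at hC
  have hsum : Tendsto (fun n : ℕ => ∑ i, ψ (u * h (a n i) * t n)) atTop
      (𝓝 ((∫ x, h x ^ β ∂ν) * u ^ β)) := by
    refine hC.congr' ?_
    filter_upwards [htn, eventually_gt_atTop 0] with n h1 h2
    have hn' : (0 : ℝ) < n := by exact_mod_cast h2
    have h3 : ψ (t n) = (n : ℝ)⁻¹ := eq_inv_of_mul_eq_one_right h1
    have h4 : 0 < P.real {ω | (t n)⁻¹ < V 0 ω} := hG.1 _ (inv_pos.2 (ht0 n))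
    have h5 : ∑ _i : Fin n, ∫ ω, (1 - Real.exp (-(t n * V 0 ω))) ∂P = 1 := by
      simpa using h1
    rw [Pi.div_apply, h5, div_div_div_cancel_right₀ h4.ne', mul_one,
      mul_div_cancel_left₀ _ (inv_pos.2 hn').ne']
  have hδ : Tendsto (fun n => ψ (u * M * t n)) atTop (𝓝 0) := by
    have h1 := (continuousOn_integral_one_sub_exp (P := P) (hVm 0) hV0) 0 (by simp)
    have h2 : Tendsto (fun n => u * M * t n) atTop (𝓝[Set.Ici 0] 0) := by
      refine tendsto_nhdsWithin_iff.2 ⟨by simpa using ht.const_mul (u * M), ?_⟩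
      exact Eventually.of_forall fun n => by
        have := ht0 n
        exact Set.mem_Ici.2 (by positivity)
    simpa [ContinuousWithinAt, Function.comp_def] using Tendsto.comp h1 h2
  have hlam : ∀ n i, 0 ≤ u * h (a n i) * t n := fun n i => by
    have h1 := hm.trans_le (hmh (a n i))
    have h2 := ht0 n
    positivity
  have hprod := tendsto_prod_one_sub (p := fun n i => ψ (u * h (a n i) * t n))
    (fun n i => integral_nonneg fun ω => by
      have := mul_nonneg (hlam n i) (hV0 ω)
      have : Real.exp (-(u * h (a n i) * t n * V 0 ω)) ≤ 1 := Real.exp_le_one_iff.2 (by linarith)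
      simpa using this)
    (fun n i => integral_one_sub_exp_mono (hVm 0) hV0 (hlam n i) (by
      have := ht0 n
      have := hhM (a n i)
      gcongr)) hδ hsum
  refine hprod.congr fun n => ?_
  have h1 := integral_exp_neg_sum hVm hVi hVid (fun i : Fin n => u * h (a n i) * t n)
  have h2 : ∀ ω, u * (t n * ∑ i : Fin n, h (a n i) * V i ω) =
      ∑ i : Fin n, u * h (a n i) * t n * V i ω := by
    intro ω
    simp only [Finset.mul_sum]
    exact Finset.sum_congr rfl fun i _ => by ring
  simp only [h2, h1]
  refine Finset.prod_congr rfl fun i _ => ?_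
  have h3 : Integrable (fun ω => Real.exp (-(u * h (a n i) * t n * V 0 ω))) P := by
    have := (integrable_const (1 : ℝ)).sub
      (integrable_one_sub_exp (P := P) (hVm 0) hV0 (hlam n i))
    exact this.congr (Eventually.of_forall fun ω => by simp)
  simp only [hψ]
  rw [integral_sub (integrable_const _) h3]
  simp

/-! ### Frullani's integral and the expected logarithm of a ratio -/

/-- Truncated Frullani integral with an explicit error bound. -/
theorem abs_frullani_sub_log_le {f : ℝ → ℝ} (hf : Continuous f)
    (hanti : AntitoneOn f (Set.Ioi 0)) (h0 : ∀ x, 0 < x → 0 ≤ f x) (h1 : ∀ x, 0 < x → f x ≤ 1)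
    {a b lo hi ε R : ℝ} (hlo : 0 < lo) (hloa : lo ≤ a) (hlob : lo ≤ b) (hahi : a ≤ hi)
    (hbhi : b ≤ hi) (hε : 0 < ε) (hR : 0 < R) :
    |(∫ u in ε..R, u⁻¹ * (f (a * u) - f (b * u))) - Real.log (b / a)| ≤
      |Real.log (b / a)| * ((1 - f (hi * ε)) + f (lo * R)) := by
  have ha : 0 < a := hlo.trans_le hloa
  have hb : 0 < b := hlo.trans_le hlob
  have hhi : 0 < hi := ha.trans_le hahi
  have hloc : LocallyIntegrableOn f (Set.Ioi 0) := hf.locallyIntegrable.locallyIntegrableOn _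
  have hint : ∀ {p q : ℝ}, 0 < p → 0 < q →
      IntervalIntegrable (fun x => x⁻¹ • f x) volume p q :=
    fun hp hq => Frullani.intervalIntegrable_inv_smul hloc hp hq
  -- Substitution leaves only integrals of `f x / x` near the two ends. On the lower one `f` is
  -- close to `1`, giving `log (b / a)`; on the upper one `f` is close to `0`.
  have hsplit : (∫ u in ε..R, u⁻¹ * (f (a * u) - f (b * u))) =
      (∫ x in (a * ε)..(b * ε), x⁻¹ • f x) - ∫ x in (a * R)..(b * R), x⁻¹ • f x := by
    have e1 : (∫ u in ε..R, u⁻¹ * (f (a * u) - f (b * u))) =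
        (∫ u in ε..R, u⁻¹ • f (a * u)) - ∫ u in ε..R, u⁻¹ • f (b * u) := by
      rw [← intervalIntegral.integral_sub
        (Frullani.intervalIntegrable_inv_smul_comp_mul hloc hε hR ha)
        (Frullani.intervalIntegrable_inv_smul_comp_mul hloc hε hR hb)]
      congr 1; ext u; simp [mul_sub]
    rw [e1, Frullani.integral_comp_mul_inv_smul ha.ne', Frullani.integral_comp_mul_inv_smul hb.ne']
    have i1 := intervalIntegral.integral_add_adjacent_intervals
      (hint (mul_pos ha hε) (mul_pos hb hε)) (hint (mul_pos hb hε) (mul_pos hb hR))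
    have i2 := intervalIntegral.integral_add_adjacent_intervals
      (hint (mul_pos ha hε) (mul_pos ha hR)) (hint (mul_pos ha hR) (mul_pos hb hR))
    linarith
  have hfhi : f (hi * ε) ≤ 1 := h1 _ (by positivity)
  have hflo : 0 ≤ f (lo * R) := h0 _ (by positivity)
  have hA := Frullani.norm_integral_inv_smul_sub_le hloc (mul_pos ha hε) (mul_pos hb hε) (V := 1)
    (δ := 1 - f (hi * ε)) (by linarith) (fun x hx => by
      have hx1 : 0 < x := lt_of_lt_of_le (lt_min (mul_pos ha hε) (mul_pos hb hε)) hx.1.le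
      have hx2 : x ≤ hi * ε := hx.2.trans (max_le (by gcongr) (by gcongr))
      have h2 := hanti (show x ∈ Set.Ioi 0 from hx1) (show hi * ε ∈ Set.Ioi 0 from mul_pos hhi hε)
        hx2
      have h3 := h1 x hx1
      rw [Real.norm_eq_abs, abs_le]
      constructor <;> linarith)
  have hB := Frullani.norm_integral_inv_smul_sub_le hloc (mul_pos ha hR) (mul_pos hb hR) (V := 0)
    (δ := f (lo * R)) hflo (fun x hx => by
      have hx2 : lo * R ≤ x :=
        le_trans (le_min (by gcongr) (by gcongr)) hx.1.le
      have hx1 : 0 < x := lt_of_lt_of_le (mul_pos hlo hR) hx2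
      have h2 := hanti (show lo * R ∈ Set.Ioi 0 from mul_pos hlo hR) (show x ∈ Set.Ioi 0 from hx1)
        hx2
      have h3 := h0 x hx1
      rw [sub_zero, Real.norm_eq_abs, abs_of_nonneg h3]
      exact h2)
  rw [mul_div_mul_right _ _ hε.ne'] at hA
  rw [mul_div_mul_right _ _ hR.ne'] at hB
  rw [hsplit]
  simp only [smul_eq_mul, mul_one, mul_zero, sub_zero, Real.norm_eq_abs] at hA hB ⊢
  rw [abs_le] at hA hB ⊢
  constructor <;> nlinarith [hA.1, hA.2, hB.1, hB.2]

theorem abs_log_le_of_mem {m M w : ℝ} (hm : 0 < m) (h1 : m ≤ w) (h2 : w ≤ M) :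
    |Real.log w| ≤ |Real.log m| + |Real.log M| := by
  have h3 := Real.log_le_log hm h1
  have h4 := Real.log_le_log (hm.trans_le h1) h2
  rw [abs_le]
  constructor
  · linarith [neg_abs_le (Real.log m), abs_nonneg (Real.log M)]
  · linarith [le_abs_self (Real.log M), abs_nonneg (Real.log m)]

/-- Truncated Frullani representation of `log W` when `W * S = R`; trivial if `S = 0`. -/
theorem abs_frullani_exp_sub_log_le {m M w s r ε L : ℝ} (hm : 0 < m) (h1 : m ≤ w) (h2 : w ≤ M)
    (hs : 0 ≤ s) (hr : w * s = r) (hε : 0 < ε) (hL : 0 < L) :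
    |(∫ u in ε..L, u⁻¹ * (Real.exp (-(u * s)) - Real.exp (-(u * r)))) - Real.log w| ≤
      (|Real.log m| + |Real.log M|) *
        ((1 - Real.exp (-(max M 1 * ε * s))) + Real.exp (-(min m 1 * L * s))) := by
  have hlog := abs_log_le_of_mem hm h1 h2
  rcases hs.eq_or_lt with rfl | hs
  -- When `s = 0` the integral vanishes and the error factor equals `1`, so the crude bound on `log
  -- w` is enough.
  · simp only [mul_zero] at hr
    subst hr
    simpa using hlog
  · have hw : 0 < w := hm.trans_le h1
    have hmin : 0 < min m 1 := lt_min hm one_pos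
    have key := abs_frullani_sub_log_le (f := fun x => Real.exp (-x)) (by fun_prop)
      (fun x _ y _ hxy => by simpa using hxy) (fun x _ => (Real.exp_pos _).le)
      (fun x hx => Real.exp_le_one_iff.2 (by linarith))
      (a := s) (b := r) (lo := min m 1 * s) (hi := max M 1 * s) (ε := ε) (R := L) (by positivity)
      (by nlinarith [min_le_right m 1])
      (by rw [← hr]; gcongr; exact (min_le_left _ _).trans h1)
      (by nlinarith [le_max_right M 1])
      (by rw [← hr]; gcongr; exact h2.trans (le_max_left _ _)) hε hL
    have e1 : r / s = w := by rw [← hr, mul_div_cancel_right₀ _ hs.ne']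
    rw [e1] at key
    have e2 : ∀ u, u⁻¹ * (Real.exp (-(u * s)) - Real.exp (-(u * r))) =
        u⁻¹ * (Real.exp (-(s * u)) - Real.exp (-(r * u))) := by
      intro u; rw [mul_comm u s, mul_comm u r]
    simp only [e2]
    refine key.trans ?_
    have h3 : max M 1 * s * ε = max M 1 * ε * s := by ring
    have h4 : min m 1 * s * L = min m 1 * L * s := by ring
    rw [h3, h4]
    have h5 : Real.exp (-(max M 1 * ε * s)) ≤ 1 := by
      have : 0 < max M 1 := lt_max_of_lt_right one_pos
      have : 0 ≤ max M 1 * ε * s := by positivity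
      exact Real.exp_le_one_iff.2 (by linarith)
    have h6 := Real.exp_pos (-(min m 1 * L * s))
    gcongr

theorem tendsto_frullani_error {β : ℝ} (hβ : 0 < β) (A : ℝ) {B : ℝ} (hB : 0 < B) :
    Tendsto (fun N : ℝ => (1 - Real.exp (-(A * N⁻¹) ^ β)) + Real.exp (-(B * N) ^ β)) atTop
      (𝓝 0) := by
  have h1 : Tendsto (fun N : ℝ => (A * N⁻¹) ^ β) atTop (𝓝 0) := by
    have := (tendsto_inv_atTop_zero (𝕜 := ℝ)).const_mul A
    rw [mul_zero] at this
    simpa [Real.zero_rpow hβ.ne', Function.comp_def] using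
      ((Real.continuousAt_rpow_const 0 β (Or.inr hβ.le)).tendsto.comp this)
  have h2 : Tendsto (fun N : ℝ => (B * N) ^ β) atTop atTop :=
    (tendsto_rpow_atTop hβ).comp (tendsto_id.const_mul_atTop hB)
  have h3 := ((Real.continuous_exp.tendsto _).comp h1.neg).const_sub 1
  have h4 := Real.tendsto_exp_neg_atTop_nhds_zero.comp h2
  simpa [Function.comp_def] using h3.add h4

/-- Truncation away from `0` bounds the integrand by `ε⁻¹` on a finite measure space, so Fubini
applies without any moment assumption on `S` or `R`. -/
theorem integral_frullani_exp {Ω : Type*} [MeasurableSpace Ω] {P : Measure Ω}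
    [IsProbabilityMeasure P] {S R : Ω → ℝ} (hS : Measurable S) (hR : Measurable R)
    (hS0 : ∀ ω, 0 ≤ S ω) (hR0 : ∀ ω, 0 ≤ R ω) {ε L : ℝ} (hε : 0 < ε) (hεL : ε ≤ L) :
    Integrable (fun ω => ∫ u in ε..L, u⁻¹ * (Real.exp (-(u * S ω)) - Real.exp (-(u * R ω)))) P ∧
    ∫ ω, (∫ u in ε..L, u⁻¹ * (Real.exp (-(u * S ω)) - Real.exp (-(u * R ω)))) ∂P =
      ∫ u in ε..L, u⁻¹ * ((∫ ω, Real.exp (-(u * S ω)) ∂P) - ∫ ω, Real.exp (-(u * R ω)) ∂P) := by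
  have hexp : ∀ {u x : ℝ}, 0 ≤ u → 0 ≤ x → Real.exp (-(u * x)) ≤ 1 := fun hu hx =>
    Real.exp_le_one_iff.2 (by have := mul_nonneg hu hx; linarith)
  have : IsFiniteMeasure (volume.restrict (Set.uIoc ε L)) := by
    rw [Set.uIoc_of_le hεL]
    infer_instance
  have hint : Integrable (Function.uncurry fun (u : ℝ) ω =>
      u⁻¹ * (Real.exp (-(u * S ω)) - Real.exp (-(u * R ω))))
      ((volume.restrict (Set.uIoc ε L)).prod P) := by
    refine Integrable.of_bound (C := ε⁻¹) (Measurable.aestronglyMeasurable ?_) ?_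
    · unfold Function.uncurry
      fun_prop
    · have : ∀ᵐ p ∂((volume.restrict (Set.uIoc ε L)).prod P), p.1 ∈ Set.uIoc ε L :=
        Measure.quasiMeasurePreserving_fst.ae (ae_restrict_mem measurableSet_uIoc)
      filter_upwards [this] with p hp
      rw [Set.uIoc_of_le hεL] at hp
      have hp0 : 0 < p.1 := hε.trans hp.1
      have h1 := hexp hp0.le (hS0 p.2)
      have h2 := hexp hp0.le (hR0 p.2)
      have h3 := Real.exp_pos (-(p.1 * S p.2))
      have h4 := Real.exp_pos (-(p.1 * R p.2))
      simp only [Function.uncurry]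
      rw [norm_mul, norm_inv, Real.norm_of_nonneg hp0.le]
      calc p.1⁻¹ * ‖Real.exp (-(p.1 * S p.2)) - Real.exp (-(p.1 * R p.2))‖ ≤ p.1⁻¹ * 1 := by
            gcongr
            rw [Real.norm_eq_abs, abs_le]
            constructor <;> linarith
        _ ≤ ε⁻¹ := by
            rw [mul_one]
            exact inv_anti₀ hε hp.1.le
  constructor
  · have := hint.integral_prod_right
    simp only [intervalIntegral.intervalIntegral_eq_integral_uIoc, Set.uIoc_of_le hεL] at this ⊢
    simpa [hεL, Function.uncurry] using this
  · rw [← intervalIntegral_integral_swap hint]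
    refine intervalIntegral.integral_congr fun u hu => ?_
    rw [Set.uIcc_of_le hεL] at hu
    have hu0 : 0 < u := hε.trans_le hu.1
    have hi : ∀ {T : Ω → ℝ}, Measurable T → (∀ ω, 0 ≤ T ω) →
        Integrable (fun ω => Real.exp (-(u * T ω))) P := fun hT hT0 =>
      Integrable.of_bound (C := 1) (Measurable.aestronglyMeasurable (by fun_prop))
        (Eventually.of_forall fun ω => by
          rw [Real.norm_eq_abs, Real.abs_exp]; exact hexp hu0.le (hT0 ω))
    rw [integral_const_mul, integral_sub (hi hS hS0) (hi hR hR0)]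

/-- The limit of `E log W` for the ratio `W` of two weighted sums of heavy-tailed variables. -/
theorem tendsto_integral_log_ratio {Ω : Type*} [MeasurableSpace Ω] {P : Measure Ω}
    [IsProbabilityMeasure P] {V : ℕ → Ω → ℝ} (hVm : ∀ j, Measurable (V j))
    (hVi : iIndepFun V P) (hVid : ∀ j, IdentDistrib (V j) (V 0) P P)
    (hV0 : ∀ j ω, 0 ≤ V j ω) {β : ℝ} (hβ0 : 0 < β) (hβ1 : β < 1)
    (hG : RegVar (fun x => P.real {ω | x < V 0 ω}) β)
    {a : (n : ℕ) → Fin n → ℝ} {ν : Measure ℝ} [IsProbabilityMeasure ν] (ha : WeakAvg a ν)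
    {h : ℝ → ℝ} (hh : Continuous h) {m M : ℝ} (hm : 0 < m) (hmh : ∀ x, m ≤ h x)
    (hhM : ∀ x, h x ≤ M) {W : ℕ → Ω → ℝ} (hWm : ∀ n, Measurable (W n))
    (hmW : ∀ n ω, m ≤ W n ω) (hWM : ∀ n ω, W n ω ≤ M)
    (hW : ∀ n ω, W n ω * ∑ i : Fin n, V i ω = ∑ i : Fin n, h (a n i) * V i ω) :
    Tendsto (fun n => ∫ ω, Real.log (W n ω) ∂P) atTop
      (𝓝 (β⁻¹ * Real.log (∫ x, h x ^ β ∂ν))) := by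
  obtain ⟨t, ht0, ht, htn⟩ := exists_laplace_scaling (P := P) (hVm 0) (hV0 0) (hG.1 1 one_pos)
  have hM : 0 < M := hm.trans_le ((hmh 0).trans (hhM 0))
  set S : ℕ → Ω → ℝ := fun n ω => t n * ∑ i : Fin n, V i ω with hS
  set R : ℕ → Ω → ℝ := fun n ω => t n * ∑ i : Fin n, h (a n i) * V i ω with hR
  have hSm : ∀ n, Measurable (S n) := fun n => by
    simp only [hS]; fun_prop
  have hRm : ∀ n, Measurable (R n) := fun n => by
    simp only [hR]; fun_prop
  have hS0 : ∀ n ω, 0 ≤ S n ω := fun n ω =>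
    mul_nonneg (ht0 n).le (Finset.sum_nonneg fun i _ => hV0 i ω)
  have hR0 : ∀ n ω, 0 ≤ R n ω := fun n ω =>
    mul_nonneg (ht0 n).le (Finset.sum_nonneg fun i _ =>
      mul_nonneg (hm.le.trans (hmh _)) (hV0 i ω))
  have hWS : ∀ n ω, W n ω * S n ω = R n ω := fun n ω => by
    simp only [hS, hR]
    rw [← hW n ω]; ring
  set c : ℝ := ∫ x, h x ^ β ∂ν with hc
  have hhβ : ∀ x, m ^ β ≤ h x ^ β ∧ h x ^ β ≤ M ^ β := fun x =>
    ⟨Real.rpow_le_rpow hm.le (hmh x) hβ0.le,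
      Real.rpow_le_rpow (hm.le.trans (hmh x)) (hhM x) hβ0.le⟩
  have hcpos : 0 < c := by
    have hint : Integrable (fun x => h x ^ β) ν := by
      refine Integrable.of_bound (C := M ^ β)
        (hh.rpow_const fun x => Or.inr hβ0.le).aestronglyMeasurable
        (Eventually.of_forall fun x => ?_)
      have h1 := hhβ x
      have h2 : 0 < m ^ β := by positivity
      rw [Real.norm_of_nonneg (h2.le.trans h1.1)]
      exact h1.2
    have h1 : ∫ _x, m ^ β ∂ν ≤ c := integral_mono (integrable_const _) hint fun x => (hhβ x).1
    have h2 : 0 < m ^ β := by positivity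
    simp at h1
    linarith
  have hr : ∀ u : ℝ, 0 < u → Tendsto (fun n => ∫ ω, Real.exp (-(u * R n ω)) ∂P) atTop
      (𝓝 (Real.exp (-(c * u ^ β)))) := fun u hu =>
    tendsto_laplace_sum hVm hVi hVid (hV0 0) hβ0 hβ1 hG ha hh hm hmh hhM ht0 ht htn hu
  have hl : ∀ u : ℝ, 0 < u → Tendsto (fun n => ∫ ω, Real.exp (-(u * S n ω)) ∂P) atTop
      (𝓝 (Real.exp (-u ^ β))) := fun u hu => by
    have := tendsto_laplace_sum hVm hVi hVid (hV0 0) hβ0 hβ1 hG ha (h := fun _ => 1)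
      continuous_const one_pos (fun _ => le_rfl) (fun _ => le_rfl) ht0 ht htn hu
    simpa [hS] using this
  set C : ℝ := |Real.log m| + |Real.log M| with hC
  have hC0 : 0 ≤ C := by positivity
  -- With `f x = exp (-x ^ β)` the limiting transforms are `f u` and `f (k * u)`, so Frullani yields
  -- `log k = β⁻¹ log c`.
  set k : ℝ := c ^ β⁻¹ with hk
  have hk0 : 0 < k := by positivity
  have hkβ : k ^ β = c := by
    rw [hk, ← Real.rpow_mul hcpos.le, inv_mul_cancel₀ hβ0.ne', Real.rpow_one]
  have hlogk : Real.log k = β⁻¹ * Real.log c := Real.log_rpow hcpos _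
  -- the errors of the truncation at `N⁻¹` and `N`
  have herr : Tendsto (fun N : ℝ =>
      C * ((1 - Real.exp (-(max M 1 * N⁻¹) ^ β)) + Real.exp (-(min m 1 * N) ^ β)) +
      |Real.log k| * ((1 - Real.exp (-(max k 1 * N⁻¹) ^ β)) + Real.exp (-(min k 1 * N) ^ β)))
      atTop (𝓝 0) := by
    have e1 := (tendsto_frullani_error hβ0 (max M 1) (B := min m 1)
      (by positivity)).const_mul C
    have e2 := (tendsto_frullani_error hβ0 (max k 1) (B := min k 1)
      (by positivity)).const_mul |Real.log k|
    simpa using e1.add e2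
  rw [Metric.tendsto_nhds]
  intro δ hδ
  obtain ⟨N, hNerr, hN1⟩ :=
    ((herr.eventually (gt_mem_nhds hδ)).and (eventually_ge_atTop 1)).exists
  have hN0 : 0 < N := one_pos.trans_le hN1
  have hNinv : 0 < N⁻¹ := by positivity
  have hNN : N⁻¹ ≤ N := (inv_le_one_of_one_le₀ hN1).trans hN1
  have hmid : Tendsto (fun n => ∫ u in N⁻¹..N, u⁻¹ * ((∫ ω, Real.exp (-(u * S n ω)) ∂P) -
      ∫ ω, Real.exp (-(u * R n ω)) ∂P)) atTop
      (𝓝 (∫ u in N⁻¹..N, u⁻¹ * (Real.exp (-u ^ β) - Real.exp (-(c * u ^ β))))) := by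
    have hbd : ∀ (T : Ω → ℝ), (∀ ω, 0 ≤ T ω) → ∀ u : ℝ, 0 ≤ u →
        0 ≤ ∫ ω, Real.exp (-(u * T ω)) ∂P ∧ ∫ ω, Real.exp (-(u * T ω)) ∂P ≤ 1 := by
      intro T hT u hu
      refine ⟨integral_nonneg fun ω => (Real.exp_pos _).le, ?_⟩
      have := integral_mono_of_nonneg (μ := P) (f := fun ω => Real.exp (-(u * T ω)))
        (g := fun _ => 1) (Eventually.of_forall fun ω => (Real.exp_pos _).le) (integrable_const _)
        (Eventually.of_forall fun ω =>
          Real.exp_le_one_iff.2 (by have := mul_nonneg hu (hT ω); linarith))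
      simpa using this
    refine intervalIntegral.tendsto_integral_filter_of_dominated_convergence (fun _ => N)
      (Eventually.of_forall fun n => ?_) (Eventually.of_forall fun n =>
        Eventually.of_forall fun u hu => ?_) (by simp) (Eventually.of_forall fun u hu => ?_)
    · refine Measurable.aestronglyMeasurable (Measurable.mul (by fun_prop) (Measurable.sub ?_ ?_))
      · refine (StronglyMeasurable.integral_prod_right (f := fun u ω => Real.exp (-(u * S n ω)))
          (Measurable.stronglyMeasurable ?_)).measurable
        have := hSm n
        unfold Function.uncurry
        fun_prop
      · refine (StronglyMeasurable.integral_prod_right (f := fun u ω => Real.exp (-(u * R n ω)))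
          (Measurable.stronglyMeasurable ?_)).measurable
        have := hRm n
        unfold Function.uncurry
        fun_prop
    · rw [Set.uIoc_of_le hNN] at hu
      have hu0 : 0 < u := hNinv.trans hu.1
      obtain ⟨a1, a2⟩ := hbd _ (hS0 n) u hu0.le
      obtain ⟨b1, b2⟩ := hbd _ (hR0 n) u hu0.le
      rw [norm_mul, norm_inv, Real.norm_of_nonneg hu0.le]
      calc _ ≤ u⁻¹ * 1 := by
            gcongr
            rw [Real.norm_eq_abs, abs_le]
            constructor <;> linarith
        _ ≤ N := by
            rw [mul_one]
            exact (inv_le_comm₀ hu0 hN0).2 hu.1.le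
    · rw [Set.uIoc_of_le hNN] at hu
      have hu0 : 0 < u := hNinv.trans hu.1
      exact ((hl u hu0).sub (hr u hu0)).const_mul _
  have hlim : |(∫ u in N⁻¹..N, u⁻¹ * (Real.exp (-u ^ β) - Real.exp (-(c * u ^ β)))) -
      β⁻¹ * Real.log c| ≤
      |Real.log k| * ((1 - Real.exp (-(max k 1 * N⁻¹) ^ β)) + Real.exp (-(min k 1 * N) ^ β)) := by
    have key := abs_frullani_sub_log_le (f := fun x => Real.exp (-x ^ β))
      (Real.continuous_exp.comp (Real.continuous_rpow_const hβ0.le).neg)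
      (fun x hx y _ hxy => by
        have := Real.rpow_le_rpow (le_of_lt hx) hxy hβ0.le
        simpa using this)
      (fun x _ => (Real.exp_pos _).le)
      (fun x hx => Real.exp_le_one_iff.2 (by have := Real.rpow_nonneg hx.le β; linarith))
      (a := 1) (b := k) (lo := min k 1) (hi := max k 1) (ε := N⁻¹) (R := N) (by positivity)
      (min_le_right _ _) (min_le_left _ _) (le_max_right _ _) (le_max_left _ _) hNinv hN0
    rw [div_one, hlogk] at key
    rw [hlogk]
    refine le_trans (le_of_eq ?_) key
    congr 2
    refine intervalIntegral.integral_congr fun u hu => ?_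
    rw [Set.uIcc_of_le hNN] at hu
    have hu0 : 0 < u := hNinv.trans_le hu.1
    rw [one_mul, Real.mul_rpow hk0.le hu0.le, hkβ]
  have hlogint : ∀ n, Integrable (fun ω => Real.log (W n ω)) P := fun n =>
    Integrable.of_bound (C := C) ((hWm n).log.aestronglyMeasurable)
      (Eventually.of_forall fun ω => abs_log_le_of_mem hm (hmW n ω) (hWM n ω))
  have hexpint : ∀ (A : ℝ) n, 0 ≤ A → Integrable (fun ω => Real.exp (-(A * S n ω))) P :=
    fun A n hA => Integrable.of_bound (C := 1)
      (Measurable.aestronglyMeasurable (by have := hSm n; fun_prop))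
      (Eventually.of_forall fun ω => by
        rw [Real.norm_eq_abs, Real.abs_exp]
        exact Real.exp_le_one_iff.2 (by have := mul_nonneg hA (hS0 n ω); linarith))
  have hpre : ∀ n, |(∫ u in N⁻¹..N, u⁻¹ * ((∫ ω, Real.exp (-(u * S n ω)) ∂P) -
      ∫ ω, Real.exp (-(u * R n ω)) ∂P)) - ∫ ω, Real.log (W n ω) ∂P| ≤
      C * ((1 - ∫ ω, Real.exp (-(max M 1 * N⁻¹ * S n ω)) ∂P) +
        ∫ ω, Real.exp (-(min m 1 * N * S n ω)) ∂P) := by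
    intro n
    obtain ⟨i1, i2⟩ := integral_frullani_exp (P := P) (hSm n) (hRm n) (hS0 n) (hR0 n) hNinv hNN
    have j1 := hexpint (max M 1 * N⁻¹) n (by positivity)
    have j2 := hexpint (min m 1 * N) n (by positivity)
    rw [← i2, ← integral_sub i1 (hlogint n)]
    refine (abs_integral_le_integral_abs).trans ?_
    have e : C * ((1 - ∫ ω, Real.exp (-(max M 1 * N⁻¹ * S n ω)) ∂P) +
        ∫ ω, Real.exp (-(min m 1 * N * S n ω)) ∂P) =
        ∫ ω, C * ((1 - Real.exp (-(max M 1 * N⁻¹ * S n ω))) +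
          Real.exp (-(min m 1 * N * S n ω))) ∂P := by
      have j3 : Integrable (fun ω => 1 - Real.exp (-(max M 1 * N⁻¹ * S n ω))) P :=
        (integrable_const _).sub j1
      rw [integral_const_mul, integral_add j3 j2, integral_sub (integrable_const _) j1]
      simp
    rw [e]
    refine integral_mono (i1.sub (hlogint n)).abs
      ((((integrable_const _).sub j1).add j2).const_mul _) fun ω => ?_
    exact abs_frullani_exp_sub_log_le hm (hmW n ω) (hWM n ω) (hS0 n ω) (hWS n ω) hNinv hN0
  have hpre_lim : Tendsto (fun n => C * ((1 - ∫ ω, Real.exp (-(max M 1 * N⁻¹ * S n ω)) ∂P) +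
      ∫ ω, Real.exp (-(min m 1 * N * S n ω)) ∂P)) atTop
      (𝓝 (C * ((1 - Real.exp (-(max M 1 * N⁻¹) ^ β)) + Real.exp (-(min m 1 * N) ^ β)))) :=
    (((hl _ (by positivity)).const_sub 1).add (hl _ (by positivity))).const_mul C
  -- Three errors: truncation before the limit, convergence of the truncated integrals, truncation
  -- after the limit. `N` was fixed so that the first (in the limit) and the third add up to less
  -- than `δ`; the second tends to `0`.
  have htot := (hpre_lim.add ((hmid.sub_const (∫ u in N⁻¹..N, u⁻¹ *
    (Real.exp (-u ^ β) - Real.exp (-(c * u ^ β))))).abs)).add_const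
    (|Real.log k| * ((1 - Real.exp (-(max k 1 * N⁻¹) ^ β)) + Real.exp (-(min k 1 * N) ^ β)))
  rw [sub_self, abs_zero, add_zero] at htot
  filter_upwards [htot.eventually (gt_mem_nhds hNerr)] with n hn
  rw [Real.dist_eq]
  refine lt_of_le_of_lt ?_ hn
  have t1 := hpre n
  rw [abs_sub_comm] at t1
  have t2 := abs_sub_le (∫ ω, Real.log (W n ω) ∂P)
    (∫ u in N⁻¹..N, u⁻¹ * ((∫ ω, Real.exp (-(u * S n ω)) ∂P) -
      ∫ ω, Real.exp (-(u * R n ω)) ∂P)) (β⁻¹ * Real.log c)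
  have t3 := abs_sub_le (∫ u in N⁻¹..N, u⁻¹ * ((∫ ω, Real.exp (-(u * S n ω)) ∂P) -
      ∫ ω, Real.exp (-(u * R n ω)) ∂P))
      (∫ u in N⁻¹..N, u⁻¹ * (Real.exp (-u ^ β) - Real.exp (-(c * u ^ β)))) (β⁻¹ * Real.log c)
  linarith

/-! ### Clipping, and analytic continuation to the Cauchy transform -/

/-- The projection of `x` to `[-T, T]`. -/
noncomputable def clip (T x : ℝ) : ℝ := max (-T) (min x T)

theorem continuous_clip (T : ℝ) : Continuous (clip T) := by
  unfold clip; fun_prop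

theorem neg_le_clip (T x : ℝ) : -T ≤ clip T x := le_max_left _ _

theorem clip_le {T : ℝ} (hT : 0 ≤ T) (x : ℝ) : clip T x ≤ T :=
  max_le (by linarith) (min_le_right _ _)

theorem abs_clip_le {T : ℝ} (hT : 0 ≤ T) (x : ℝ) : |clip T x| ≤ T :=
  abs_le.2 ⟨neg_le_clip T x, clip_le hT x⟩

theorem clip_eq_self {T x : ℝ} (h : |x| ≤ T) : clip T x = x := by
  rw [abs_le] at h
  rw [clip, min_eq_left h.2, max_eq_right h.1]

theorem abs_clip_le_abs {T : ℝ} (hT : 0 ≤ T) (x : ℝ) : |clip T x| ≤ |x| := by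
  by_cases h : |x| ≤ T
  · rw [clip_eq_self h]
  · exact (abs_clip_le hT x).trans (not_le.1 h).le

theorem abs_sub_clip_le {T : ℝ} (hT : 0 ≤ T) (x : ℝ) :
    |x - clip T x| ≤ Set.indicator {x : ℝ | T < |x|} (fun x => |x|) x := by
  by_cases h : T < |x|
  · rw [Set.indicator_of_mem (by exact h)]
    unfold clip
    rcases abs_cases x with ⟨h1, h2⟩ | ⟨h1, h2⟩
    · rw [h1] at h ⊢
      rw [min_eq_right h.le, max_eq_right (by linarith), abs_of_nonneg (by linarith)]
      linarith
    · rw [h1] at h ⊢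
      rw [min_eq_left (by linarith), max_eq_left (by linarith), abs_of_nonpos (by linarith)]
      linarith
  · rw [Set.indicator_of_notMem (by exact h), clip_eq_self (not_lt.1 h)]
    simp

theorem add_ofReal_mem_slitPlane {w : ℂ} (hw : w ∈ Complex.slitPlane) {r : ℝ} (hr : 0 ≤ r) :
    w + r ∈ Complex.slitPlane := by
  rw [Complex.mem_slitPlane_iff] at hw ⊢
  simp only [Complex.add_re, Complex.ofReal_re, Complex.add_im, Complex.ofReal_im, add_zero]
  exact hw.imp (fun h => by linarith) id

theorem sub_ofReal_mem_slitPlane {w : ℂ} {T x : ℝ} (hw : w - T ∈ Complex.slitPlane)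
    (hx : x ≤ T) : w - x ∈ Complex.slitPlane := by
  have := add_ofReal_mem_slitPlane hw (sub_nonneg.2 hx)
  convert this using 1
  push_cast
  ring

/-- For `w` in a small closed ball and clipped values in `[-T, T]`, the differences stay in a
compact subset of the slit plane. There `f` and `f'` are bounded, which justifies differentiation
under the integral. -/
theorem hasDerivAt_integral_sub_clip {ρ : Measure ℝ} [IsFiniteMeasure ρ] {f f' : ℂ → ℂ}
    (hf : ∀ w ∈ Complex.slitPlane, HasDerivAt f (f' w) w)
    (hf' : ContinuousOn f' Complex.slitPlane) {T : ℝ} (hT : 0 ≤ T) {w₀ : ℂ}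
    (hw₀ : w₀ - T ∈ Complex.slitPlane) :
    HasDerivAt (fun w : ℂ => ∫ x, f (w - (clip T x : ℝ)) ∂ρ)
      (∫ x, f' (w₀ - (clip T x : ℝ)) ∂ρ) w₀ := by
  have hopen : IsOpen {w : ℂ | w - T ∈ Complex.slitPlane} :=
    Complex.isOpen_slitPlane.preimage (by fun_prop)
  obtain ⟨r, hr, hball⟩ := Metric.nhds_basis_closedBall.mem_iff.1 (hopen.mem_nhds hw₀)
  have hslit : ∀ w : ℂ, w - T ∈ Complex.slitPlane → ∀ x, w - (clip T x : ℝ) ∈ Complex.slitPlane :=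
    fun w hw x => sub_ofReal_mem_slitPlane hw (clip_le hT x)
  have hcont : ∀ (g : ℂ → ℂ), ContinuousOn g Complex.slitPlane → ∀ w : ℂ,
      w - T ∈ Complex.slitPlane → Continuous fun x => g (w - (clip T x : ℝ)) := by
    intro g hg w hw
    refine hg.comp_continuous ?_ (hslit w hw)
    have := continuous_clip T
    fun_prop
  have hfc : ContinuousOn f Complex.slitPlane := fun w hw =>
    (hf w hw).continuousAt.continuousWithinAt
  have hbdd : ∀ (g : ℂ → ℂ), ContinuousOn g Complex.slitPlane → ∃ C : ℝ, ∀ w ∈ Metric.closedBall w₀ r,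
      ∀ x, ‖g (w - (clip T x : ℝ))‖ ≤ C := by
    intro g hg
    have hK : IsCompact ((fun p : ℂ × ℝ => p.1 - (p.2 : ℂ)) ''
        (Metric.closedBall w₀ r ×ˢ Set.Icc (-T) T)) :=
      ((isCompact_closedBall _ _).prod isCompact_Icc).image (by fun_prop)
    obtain ⟨C, hC⟩ := hK.exists_bound_of_continuousOn (hg.mono (by
      rintro _ ⟨p, hp, rfl⟩
      exact sub_ofReal_mem_slitPlane (hball hp.1) hp.2.2))
    exact ⟨C, fun w hw x => hC _ ⟨(w, clip T x), ⟨hw, neg_le_clip T x, clip_le hT x⟩, rfl⟩⟩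
  obtain ⟨C, hC⟩ := hbdd f hfc
  obtain ⟨C', hC'⟩ := hbdd f' hf'
  refine (hasDerivAt_integral_of_dominated_loc_of_deriv_le (μ := ρ)
    (F := fun (w : ℂ) (x : ℝ) => f (w - (clip T x : ℝ)))
    (F' := fun (w : ℂ) (x : ℝ) => f' (w - (clip T x : ℝ))) (bound := fun _ => C')
    (Metric.closedBall_mem_nhds w₀ hr) ?_ ?_ ?_ ?_ (integrable_const (μ := ρ) C') ?_).2
  · filter_upwards [hopen.mem_nhds hw₀] with w hw
    exact (hcont f hfc w hw).aestronglyMeasurable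
  · exact Integrable.of_bound (hcont f hfc w₀ hw₀).aestronglyMeasurable C
      (Eventually.of_forall fun x => hC w₀ (Metric.mem_closedBall_self hr.le) x)
  · exact (hcont f' hf' w₀ hw₀).aestronglyMeasurable
  · exact Eventually.of_forall fun x w hw => hC' w hw x
  · refine Eventually.of_forall fun x w hw => ?_
    have := (hf _ (hslit w (hball hw) x)).comp_sub_const w (clip T x : ℂ)
    exact this

theorem isPreconnected_shifted_slitPlane (T : ℝ) :
    IsPreconnected {w : ℂ | w - T ∈ Complex.slitPlane} := by
  have h : IsPreconnected Complex.slitPlane :=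
    (Complex.starConvex_one_slitPlane.isPathConnected
      Complex.one_mem_slitPlane).isConnected.isPreconnected
  have := h.image (fun w : ℂ => w + T) (by fun_prop)
  convert this using 1
  ext w
  constructor
  · intro hw
    exact ⟨w - T, hw, by ring⟩
  · rintro ⟨v, hv, rfl⟩
    simpa using hv

theorem hasDerivAt_cpow_ofReal (β : ℝ) {w : ℂ} (hw : w ∈ Complex.slitPlane) :
    HasDerivAt (fun w : ℂ => w ^ (β : ℂ)) (β * w ^ ((β - 1 : ℝ) : ℂ)) w := by
  have := (hasDerivAt_id w).cpow_const (c := (β : ℂ)) hw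
  simpa using this

/-- A logarithmic identity on a real half-line determines the Cauchy transform. -/
theorem cauchy_transform_clip_of_log {β T : ℝ} (hβ : 0 < β) (hT : 0 ≤ T) {μ ν : Measure ℝ}
    [IsProbabilityMeasure μ] [IsProbabilityMeasure ν]
    (hlog : ∀ z : ℝ, T < z → ∫ x, Real.log (z - clip T x) ∂μ =
      β⁻¹ * Real.log (∫ x, (z - clip T x) ^ β ∂ν)) {w : ℂ} (hw : w - T ∈ Complex.slitPlane) :
    (∫ x, (w - (clip T x : ℝ))⁻¹ ∂μ) * ∫ x, (w - (clip T x : ℝ)) ^ (β : ℂ) ∂ν =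
      ∫ x, (w - (clip T x : ℝ)) ^ ((β - 1 : ℝ) : ℂ) ∂ν := by
  set D : Set ℂ := {w : ℂ | w - T ∈ Complex.slitPlane} with hD
  have hopen : IsOpen D := Complex.isOpen_slitPlane.preimage (by fun_prop)
  set F : ℂ → ℂ := fun w => ∫ x, (w - (clip T x : ℝ)) ^ (β : ℂ) ∂ν with hF
  set G : ℂ → ℂ := fun w => ∫ x, Complex.log (w - (clip T x : ℝ)) ∂μ with hG
  have hF' : ∀ w ∈ D, HasDerivAt F (∫ x, β * (w - (clip T x : ℝ)) ^ ((β - 1 : ℝ) : ℂ) ∂ν) w :=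
    fun w hw => hasDerivAt_integral_sub_clip (f := fun w => w ^ (β : ℂ))
      (f' := fun w => β * w ^ ((β - 1 : ℝ) : ℂ)) (fun w hw => hasDerivAt_cpow_ofReal β hw)
      (fun w hw => (((hasDerivAt_cpow_ofReal (β - 1) hw).continuousAt).const_mul
        _).continuousWithinAt) hT hw
  have hG' : ∀ w ∈ D, HasDerivAt G (∫ x, (w - (clip T x : ℝ))⁻¹ ∂μ) w :=
    fun w hw => hasDerivAt_integral_sub_clip (f := Complex.log) (f' := fun w => w⁻¹)
      (fun w hw => Complex.hasDerivAt_log hw)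
      (fun w hw => (continuousAt_inv₀ (Complex.slitPlane_ne_zero hw)).continuousWithinAt) hT hw
  have hexpG' : ∀ w ∈ D, HasDerivAt (fun w => Complex.exp (β * G w))
      (Complex.exp (β * G w) * (β * ∫ x, (w - (clip T x : ℝ))⁻¹ ∂μ)) w :=
    fun w hw => ((hG' w hw).const_mul _).cexp
  have hreal : ∀ z : ℝ, T < z → F z = Complex.exp (β * G z) := by
    intro z hz
    have hpos : ∀ x, 0 < z - clip T x := fun x => by
      have := clip_le hT x
      linarith
    have e1 : F z = ((∫ x, (z - clip T x) ^ β ∂ν : ℝ) : ℂ) := by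
      rw [hF, ← integral_complex_ofReal]
      refine integral_congr_ae (Eventually.of_forall fun x => ?_)
      simp only
      rw [Complex.ofReal_cpow (hpos x).le]
      push_cast
      rfl
    have e2 : G z = ((∫ x, Real.log (z - clip T x) ∂μ : ℝ) : ℂ) := by
      rw [hG, ← integral_complex_ofReal]
      refine integral_congr_ae (Eventually.of_forall fun x => ?_)
      simp only
      rw [Complex.ofReal_log (hpos x).le]
      push_cast
      rfl
    have hc : 0 < ∫ x, (z - clip T x) ^ β ∂ν := by
      have h1 : ∀ x, (z - T) ^ β ≤ (z - clip T x) ^ β := fun x =>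
        Real.rpow_le_rpow (by linarith) (by linarith [clip_le hT x]) hβ.le
      have h2 : ∀ x, (z - clip T x) ^ β ≤ (z + T) ^ β := fun x =>
        Real.rpow_le_rpow (hpos x).le (by linarith [neg_le_clip T x]) hβ.le
      have hint : Integrable (fun x => (z - clip T x) ^ β) ν := by
        refine Integrable.of_bound (C := (z + T) ^ β) (Continuous.aestronglyMeasurable ?_)
          (Eventually.of_forall fun x => ?_)
        · exact (continuous_const.sub (continuous_clip T)).rpow_const fun x => Or.inr hβ.le
        · rw [Real.norm_of_nonneg (Real.rpow_nonneg (hpos x).le _)]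
          exact h2 x
      have h3 := integral_mono (integrable_const _) hint h1
      have h4 : 0 < (z - T) ^ β := Real.rpow_pos_of_pos (by linarith) _
      simp at h3
      linarith
    rw [e1, e2, hlog z hz, ← Complex.ofReal_mul, ← mul_assoc, mul_inv_cancel₀ hβ.ne', one_mul,
      ← Complex.ofReal_exp, Real.exp_log hc]
  -- Exponentiating avoids a branch of `log F`: both sides are holomorphic on the connected cut
  -- domain and agree on a real half-line, hence everywhere.
  have heq : Set.EqOn F (fun w => Complex.exp (β * G w)) D := by
    refine AnalyticOnNhd.eqOn_of_preconnected_of_frequently_eq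
      (DifferentiableOn.analyticOnNhd (fun w hw => (hF' w hw).differentiableAt.differentiableWithinAt)
        hopen)
      (DifferentiableOn.analyticOnNhd
        (fun w hw => (hexpG' w hw).differentiableAt.differentiableWithinAt) hopen)
      (isPreconnected_shifted_slitPlane T) (z₀ := ((T + 1 : ℝ) : ℂ)) ?_ ?_
    · have : ((T + 1 : ℝ) : ℂ) - T = 1 := by push_cast; ring
      change ((T + 1 : ℝ) : ℂ) - T ∈ Complex.slitPlane
      rw [this]
      exact Complex.one_mem_slitPlane
    · have htend : Tendsto (fun x : ℝ => (x : ℂ)) (𝓝[≠] (T + 1)) (𝓝[≠] ((T + 1 : ℝ) : ℂ)) := by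
        refine tendsto_nhdsWithin_iff.2
          ⟨(Complex.continuous_ofReal.tendsto _).mono_left nhdsWithin_le_nhds, ?_⟩
        filter_upwards [self_mem_nhdsWithin] with x hx
        exact fun h => hx (Complex.ofReal_injective h)
      refine htend.frequently (Eventually.frequently ?_)
      have : ∀ᶠ x : ℝ in 𝓝[≠] (T + 1), T < x :=
        nhdsWithin_le_nhds (lt_mem_nhds (by linarith))
      exact this.mono fun x hx => hreal x hx
  -- Differentiating `F = exp (β G)` gives `F' = β G' F`, where `G'` is the Cauchy transform of `μ`;
  -- the factor `β` from the power rule cancels.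
  have hder := ((hF' w hw).congr_of_eventuallyEq
    (heq.symm.eventuallyEq_of_mem (hopen.mem_nhds hw))).unique (hexpG' w hw)
  have hFw : F w = Complex.exp (β * G w) := heq hw
  rw [integral_const_mul, ← hFw] at hder
  have hβ' : (β : ℂ) ≠ 0 := by exact_mod_cast hβ.ne'
  have : (β : ℂ) * ((∫ x, (w - (clip T x : ℝ))⁻¹ ∂μ) * F w) =
      β * ∫ x, (w - (clip T x : ℝ)) ^ ((β - 1 : ℝ) : ℂ) ∂ν := by
    rw [hder]; ring
  exact mul_left_cancel₀ hβ' this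

theorem abs_im_le_norm_sub_ofReal (w : ℂ) (x : ℝ) : |w.im| ≤ ‖w - x‖ := by
  simpa using Complex.abs_im_le_norm (w - x)

theorem sub_ofReal_mem_slitPlane_of_im_ne_zero {w : ℂ} (hw : w.im ≠ 0) (x : ℝ) :
    w - x ∈ Complex.slitPlane := by
  rw [Complex.mem_slitPlane_iff]
  right
  simpa using hw

theorem norm_sub_cpow_le_of_pos {β : ℝ} (hβ0 : 0 < β) (hβ1 : β < 1) (w : ℂ) (x : ℝ) :
    ‖(w - x) ^ (β : ℂ)‖ ≤ 1 + ‖w‖ + |x| := by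
  have h1 : ‖w - x‖ ≤ ‖w‖ + |x| := by simpa using norm_sub_le w (x : ℂ)
  rw [Complex.norm_cpow_real]
  rcases le_total ‖w - x‖ 1 with h | h
  · have := Real.rpow_le_one (norm_nonneg _) h hβ0.le
    have := norm_nonneg w
    have := abs_nonneg x
    linarith
  · have := Real.rpow_le_rpow_of_exponent_le h hβ1.le
    rw [Real.rpow_one] at this
    linarith

theorem tendsto_clip_atTop (x : ℝ) : Tendsto (fun T : ℕ => clip T x) atTop (𝓝 x) := by
  refine tendsto_const_nhds.congr' ?_
  filter_upwards [tendsto_natCast_atTop_atTop.eventually (eventually_ge_atTop |x|)] with T hT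
  exact (clip_eq_self hT).symm

theorem tendsto_integral_cpow_clip {ν : Measure ℝ} [IsProbabilityMeasure ν] {w : ℂ}
    (hw : w.im ≠ 0) {s : ℝ} {b : ℝ → ℝ} (hb : Integrable b ν)
    (hbound : ∀ (T : ℕ) x, ‖(w - (clip T x : ℝ)) ^ (s : ℂ)‖ ≤ b x) :
    Tendsto (fun T : ℕ => ∫ x, (w - (clip T x : ℝ)) ^ (s : ℂ) ∂ν) atTop
      (𝓝 (powerIntegral ν s w)) := by
  have hc : ContinuousOn (fun z : ℂ => z ^ (s : ℂ)) Complex.slitPlane := fun z hz =>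
    (hasDerivAt_cpow_ofReal s hz).continuousAt.continuousWithinAt
  refine tendsto_integral_of_dominated_convergence b (fun T => ?_) hb
    (fun T => Eventually.of_forall (hbound T)) (Eventually.of_forall fun x => ?_)
  · refine Continuous.aestronglyMeasurable (hc.comp_continuous ?_ fun x =>
      sub_ofReal_mem_slitPlane_of_im_ne_zero hw _)
    have := continuous_clip T
    fun_prop
  · have h1 := (hasDerivAt_cpow_ofReal s
      (sub_ofReal_mem_slitPlane_of_im_ne_zero hw x)).continuousAt.tendsto
    refine h1.comp ?_
    exact tendsto_const_nhds.sub ((Complex.continuous_ofReal.tendsto _).comp (tendsto_clip_atTop x))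

theorem tendsto_integral_cpow_clip_pos {ν : Measure ℝ} [IsProbabilityMeasure ν]
    (hν : Integrable (fun x : ℝ => |x|) ν) {β : ℝ} (hβ0 : 0 < β) (hβ1 : β < 1) {w : ℂ}
    (hw : w.im ≠ 0) :
    Tendsto (fun T : ℕ => ∫ x, (w - (clip T x : ℝ)) ^ (β : ℂ) ∂ν) atTop
      (𝓝 (powerIntegral ν β w)) := by
  refine tendsto_integral_cpow_clip hw (b := fun x => 1 + ‖w‖ + |x|)
    ((integrable_const _).add hν) fun T x => ?_
  refine (norm_sub_cpow_le_of_pos hβ0 hβ1 w _).trans ?_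
  have := abs_clip_le_abs (T := T) (by positivity) x
  linarith

theorem tendsto_integral_cpow_clip_neg {ν : Measure ℝ} [IsProbabilityMeasure ν]
    {β : ℝ} (hβ1 : β < 1) {w : ℂ} (hw : w.im ≠ 0) :
    Tendsto (fun T : ℕ => ∫ x, (w - (clip T x : ℝ)) ^ ((β - 1 : ℝ) : ℂ) ∂ν) atTop
      (𝓝 (powerIntegral ν (β - 1) w)) := by
  refine tendsto_integral_cpow_clip hw (b := fun x => |w.im| ^ (β - 1))
    (integrable_const _) fun T x => ?_
  rw [Complex.norm_cpow_real]
  exact Real.rpow_le_rpow_of_nonpos (abs_pos.2 hw) (abs_im_le_norm_sub_ofReal w _) (by linarith)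

/-! ### Stieltjes inversion and uniqueness -/

theorem integral_cauchy_kernel (g : ℝ → ℝ) {η : ℝ} (hη : 0 < η) (x : ℝ) :
    ∫ y, g y * (η / ((x - y) ^ 2 + η ^ 2)) = ∫ u, g (x + η * u) * (1 + u ^ 2)⁻¹ := by
  have h1 : ∀ u : ℝ, g (x + η * u) * (1 + u ^ 2)⁻¹ =
      η * (fun y => g y * (η / ((x - y) ^ 2 + η ^ 2))) (x + η * u) := by
    intro u
    simp only
    have : (x - (x + η * u)) ^ 2 + η ^ 2 = η ^ 2 * (1 + u ^ 2) := by ring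
    rw [this]
    field_simp
  simp only [h1]
  rw [integral_const_mul,
    Measure.integral_comp_mul_left (fun v => (fun y => g y * (η / ((x - y) ^ 2 + η ^ 2))) (x + v)) η,
    integral_add_left_eq_self (fun y => g y * (η / ((x - y) ^ 2 + η ^ 2))) x,
    abs_of_pos (inv_pos.2 hη), smul_eq_mul, ← mul_assoc, mul_inv_cancel₀ hη.ne', one_mul]

theorem integrable_cauchy_kernel {η : ℝ} (hη : 0 < η) (x : ℝ) :
    Integrable fun y => η / ((x - y) ^ 2 + η ^ 2) := by
  have h1 := ((integrable_inv_one_add_sq.comp_mul_left' (inv_pos.2 hη).ne').comp_sub_left x).const_mul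
    η⁻¹
  refine h1.congr (Eventually.of_forall fun y => ?_)
  simp only
  field_simp
  ring

theorem norm_sub_ge_im (x : ℝ) (z : ℂ) : |z.im| ≤ ‖(x : ℂ) - z‖ := by
  simpa using Complex.abs_im_le_norm ((x : ℂ) - z)

theorem integrable_stieltjes_kernel {μ : Measure ℝ} [IsFiniteMeasure μ] {z : ℂ}
    (hz : z.im ≠ 0) : Integrable (fun x : ℝ => 1 / ((x : ℂ) - z)) μ := by
  refine Integrable.of_bound (C := |z.im|⁻¹) (Measurable.aestronglyMeasurable (by fun_prop))
    (Eventually.of_forall fun x => ?_)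
  rw [norm_div, norm_one, one_div]
  exact inv_anti₀ (abs_pos.2 hz) (norm_sub_ge_im x z)

theorem im_stieltjesTransform {μ : Measure ℝ} [IsFiniteMeasure μ] {η : ℝ} (hη : 0 < η) (y : ℝ) :
    (stieltjesTransform μ (y + η * Complex.I)).im = ∫ x, η / ((x - y) ^ 2 + η ^ 2) ∂μ := by
  have hz : ((y : ℂ) + η * Complex.I).im ≠ 0 := by simpa using hη.ne'
  have h := integral_im (integrable_stieltjes_kernel (μ := μ) hz)
  unfold stieltjesTransform
  refine Eq.trans h.symm (integral_congr_ae (Eventually.of_forall fun x => ?_))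
  simp [Complex.normSq_apply]
  congr 1
  ring

/-- The imaginary part on height `η` is the unnormalized Poisson kernel integrated against `μ`.
Fubini moves the smoothing onto `f`, and `f (x + η u)` tends to `f x` under the weight `(1 + u ^
2)⁻¹` of total mass `π`. -/
theorem tendsto_integral_im_stieltjes {μ : Measure ℝ} [IsProbabilityMeasure μ]
    (f : BoundedContinuousFunction ℝ ℝ) :
    Tendsto (fun η : ℝ => ∫ y, f y * (stieltjesTransform μ (y + η * Complex.I)).im) (𝓝[>] 0)
      (𝓝 (Real.pi * ∫ x, f x ∂μ)) := by
  have hswap : ∀ η : ℝ, 0 < η → ∫ y, f y * (stieltjesTransform μ (y + η * Complex.I)).im =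
      ∫ x, (∫ u, f (x + η * u) * (1 + u ^ 2)⁻¹) ∂μ := by
    intro η hη
    simp only [im_stieltjesTransform hη, ← integral_const_mul]
    rw [← integral_integral_swap]
    · refine integral_congr_ae (Eventually.of_forall fun x => ?_)
      exact integral_cauchy_kernel f hη x
    · have hmeas : Measurable (Function.uncurry fun x y : ℝ => f y * (η / ((x - y) ^ 2 + η ^ 2))) := by
        have := f.continuous.measurable
        unfold Function.uncurry
        fun_prop
      have hdom : Integrable (Function.uncurry fun x y : ℝ => ‖f‖ * (η / ((x - y) ^ 2 + η ^ 2)))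
          (μ.prod volume) := by
        have hm : Measurable (Function.uncurry fun x y : ℝ => ‖f‖ * (η / ((x - y) ^ 2 + η ^ 2))) := by
          unfold Function.uncurry
          fun_prop
        rw [integrable_prod_iff hm.aestronglyMeasurable]
        refine ⟨Eventually.of_forall fun x => (integrable_cauchy_kernel hη x).const_mul _, ?_⟩
        have : ∀ x : ℝ, ∫ y, ‖Function.uncurry (fun x y : ℝ =>
            ‖f‖ * (η / ((x - y) ^ 2 + η ^ 2))) (x, y)‖ = ‖f‖ * Real.pi := by
          intro x
          have e : ∀ y : ℝ, ‖Function.uncurry (fun x y : ℝ =>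
            ‖f‖ * (η / ((x - y) ^ 2 + η ^ 2))) (x, y)‖ = ‖f‖ * (η / ((x - y) ^ 2 + η ^ 2)) := by
            intro y
            rw [Real.norm_of_nonneg]
            · rfl
            · simp only [Function.uncurry]; positivity
          simp only [e]
          rw [integral_cauchy_kernel (fun _ => ‖f‖) hη x, integral_const_mul,
            integral_univ_inv_one_add_sq]
        simp only [this]
        exact integrable_const _
      refine hdom.mono' hmeas.aestronglyMeasurable (Eventually.of_forall fun p => ?_)
      simp only [Function.uncurry]
      rw [norm_mul, Real.norm_of_nonneg (by positivity : 0 ≤ η / ((p.1 - p.2) ^ 2 + η ^ 2))]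
      gcongr
      exact f.norm_coe_le_norm _
  have hinner : ∀ x : ℝ, Tendsto (fun η : ℝ => ∫ u, f (x + η * u) * (1 + u ^ 2)⁻¹) (𝓝[>] 0)
      (𝓝 (f x * Real.pi)) := by
    intro x
    rw [← integral_univ_inv_one_add_sq, ← integral_const_mul]
    refine tendsto_integral_filter_of_dominated_convergence (fun u => ‖f‖ * (1 + u ^ 2)⁻¹)
      (Eventually.of_forall fun η => ?_) (Eventually.of_forall fun η => Eventually.of_forall fun u => ?_)
      (integrable_inv_one_add_sq.const_mul _) (Eventually.of_forall fun u => ?_)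
    · have := f.continuous.measurable
      exact Measurable.aestronglyMeasurable (by fun_prop)
    · rw [norm_mul, Real.norm_of_nonneg (by positivity : 0 ≤ (1 + u ^ 2)⁻¹)]
      gcongr
      exact f.norm_coe_le_norm _
    · have h1 : Continuous fun η : ℝ => f (x + η * u) * (1 + u ^ 2)⁻¹ := by
        have := f.continuous
        fun_prop
      have := h1.tendsto 0
      simp only [zero_mul, add_zero] at this
      exact this.mono_left nhdsWithin_le_nhds
  have houter : Tendsto (fun η : ℝ => ∫ x, (∫ u, f (x + η * u) * (1 + u ^ 2)⁻¹) ∂μ) (𝓝[>] 0)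
      (𝓝 (∫ x, f x * Real.pi ∂μ)) := by
    refine tendsto_integral_filter_of_dominated_convergence (fun _ => ‖f‖ * Real.pi)
      (Eventually.of_forall fun η => ?_) (Eventually.of_forall fun η => Eventually.of_forall fun x => ?_)
      (integrable_const _) (Eventually.of_forall hinner)
    · refine (StronglyMeasurable.integral_prod_right
        (f := fun x u => f (x + η * u) * (1 + u ^ 2)⁻¹) (Measurable.stronglyMeasurable ?_)).aestronglyMeasurable
      have := f.continuous.measurable
      unfold Function.uncurry
      fun_prop
    · rw [← integral_univ_inv_one_add_sq, ← integral_const_mul]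
      refine norm_integral_le_of_norm_le (integrable_inv_one_add_sq.const_mul _)
        (Eventually.of_forall fun u => ?_)
      rw [norm_mul, Real.norm_of_nonneg (by positivity : 0 ≤ (1 + u ^ 2)⁻¹)]
      gcongr
      exact f.norm_coe_le_norm _
  rw [integral_mul_const, mul_comm] at houter
  refine houter.congr' ?_
  filter_upwards [self_mem_nhdsWithin] with η hη
  exact (hswap η hη).symm

/-- A probability measure is determined by its Stieltjes transform on the upper half-plane. -/
theorem eq_of_stieltjesTransform_eq {μ μ' : Measure ℝ} [IsProbabilityMeasure μ]
    [IsProbabilityMeasure μ']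
    (h : ∀ z : ℂ, 0 < z.im → stieltjesTransform μ z = stieltjesTransform μ' z) : μ = μ' := by
  refine ext_of_forall_integral_eq_of_IsFiniteMeasure fun f => ?_
  have h1 := tendsto_integral_im_stieltjes (μ := μ) f
  have h2 := tendsto_integral_im_stieltjes (μ := μ') f
  have h3 := h1.congr' (f₂ := fun η : ℝ => ∫ y, f y *
    (stieltjesTransform μ' (y + η * Complex.I)).im) (by
      filter_upwards [self_mem_nhdsWithin] with η hη
      have hη : 0 < η := hη
      refine integral_congr_ae (Eventually.of_forall fun y => ?_)
      simp only
      rw [h _ (by simpa using hη)])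
  exact mul_left_cancel₀ Real.pi_ne_zero (tendsto_nhds_unique h3 h2)

/-! ### The hull of the support: integrability, nonvanishing, boundary values -/

/-- A neighbourhood of `x` misses `S`, and points of `S` on both sides of `x` would put `x` in the
hull. This one-dimensional fact is why the hull of a closed set is closed here. -/
theorem exists_gap_of_notMem_convexHull {S : Set ℝ} (hS : IsClosed S) {x : ℝ}
    (hx : x ∉ convexHull ℝ S) :
    ∃ ε > 0, (∀ y ∈ S, x + ε ≤ y) ∨ ∀ y ∈ S, y ≤ x - ε := by
  have hxS : x ∉ S := fun h => hx (subset_convexHull ℝ S h)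
  obtain ⟨ε, hε, hball⟩ := Metric.isOpen_iff.1 hS.isOpen_compl x hxS
  have hfar : ∀ y ∈ S, ε ≤ |y - x| := by
    intro y hy
    by_contra! h
    exact hball (by rwa [Metric.mem_ball, Real.dist_eq]) hy
  refine ⟨ε, hε, ?_⟩
  by_contra! h
  obtain ⟨⟨y₁, hy₁, h1⟩, y₂, hy₂, h2⟩ := h
  have h3 := hfar y₁ hy₁
  have h4 := hfar y₂ hy₂
  have h5 : y₁ ≤ x := by
    by_contra! h5
    rw [abs_of_pos (by linarith)] at h3
    linarith
  have h6 : x ≤ y₂ := by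
    by_contra! h6
    rw [abs_of_neg (by linarith)] at h4
    linarith
  exact hx ((convex_convexHull ℝ S).ordConnected.out (subset_convexHull ℝ S hy₁)
    (subset_convexHull ℝ S hy₂) ⟨h5, h6⟩)

theorem isClosed_convexHull_of_isClosed {S : Set ℝ} (hS : IsClosed S) :
    IsClosed (convexHull ℝ S) := by
  rw [← isOpen_compl_iff, Metric.isOpen_iff]
  intro x hx
  obtain ⟨ε, hε, h⟩ := exists_gap_of_notMem_convexHull hS hx
  refine ⟨ε, hε, fun y hy hyK => ?_⟩
  rw [Metric.mem_ball, Real.dist_eq, abs_lt] at hy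
  rcases h with h | h
  · have : y ∈ Set.Ici (x + ε) := convexHull_min h (convex_Ici _) hyK
    have := Set.mem_Ici.1 this
    linarith
  · have : y ∈ Set.Iic (x - ε) := convexHull_min h (convex_Iic _) hyK
    have := Set.mem_Iic.1 this
    linarith

theorem exists_le_norm_sub_of_notMem_supportHull {ν : Measure ℝ} {z : ℂ}
    (hz : z ∉ supportHull ν) : ∃ d > 0, ∀ x ∈ convexHull ℝ ν.support, d ≤ ‖z - (x : ℂ)‖ := by
  by_cases him : z.im = 0
  · have hzre : (z.re : ℂ) = z := by
      apply Complex.ext <;> simp [him]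
    have hre : z.re ∉ convexHull ℝ ν.support := fun h => hz ⟨z.re, h, hzre⟩
    have hcl := isClosed_convexHull_of_isClosed (Measure.isClosed_support (μ := ν))
    obtain ⟨ε, hε, hball⟩ := Metric.isOpen_iff.1 hcl.isOpen_compl _ hre
    refine ⟨ε, hε, fun x hx => ?_⟩
    by_contra! h
    refine hball ?_ hx
    rw [Metric.mem_ball, dist_comm, Real.dist_eq]
    rwa [← hzre, ← Complex.ofReal_sub, Complex.norm_real] at h
  · exact ⟨|z.im|, abs_pos.2 him, fun x _ => abs_im_le_norm_sub_ofReal z x⟩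

theorem ae_mem_convexHull_support (ν : Measure ℝ) : ∀ᵐ x ∂ν, x ∈ convexHull ℝ ν.support := by
  filter_upwards [Measure.support_mem_ae (μ := ν)] with x hx
  exact subset_convexHull ℝ _ hx

theorem measurable_sub_cpow (z : ℂ) (s : ℝ) : Measurable fun x : ℝ => (z - (x : ℂ)) ^ (s : ℂ) := by
  fun_prop

theorem norm_cpow_le_of_le {s d : ℝ} (hd : 0 < d) (hs : s ≤ 0) {z : ℂ} (hz : d ≤ ‖z‖) :
    ‖z ^ (s : ℂ)‖ ≤ d ^ s := by
  rw [Complex.norm_cpow_real]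
  exact Real.rpow_le_rpow_of_nonpos hd hz hs

theorem integrable_sub_cpow_neg {ν : Measure ℝ} [IsProbabilityMeasure ν] {s : ℝ} (hs : s ≤ 0)
    {z : ℂ} (hz : z ∉ supportHull ν) : Integrable (fun x : ℝ => (z - (x : ℂ)) ^ (s : ℂ)) ν := by
  obtain ⟨d, hd, hdz⟩ := exists_le_norm_sub_of_notMem_supportHull hz
  refine Integrable.of_bound (C := d ^ s) (measurable_sub_cpow z s).aestronglyMeasurable ?_
  filter_upwards [ae_mem_convexHull_support ν] with x hx
  exact norm_cpow_le_of_le hd hs (hdz x hx)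

theorem integrable_sub_cpow_pos {ν : Measure ℝ} [IsProbabilityMeasure ν]
    (hν : Integrable (fun x : ℝ => |x|) ν) {β : ℝ} (hβ0 : 0 < β) (hβ1 : β < 1) (z : ℂ) :
    Integrable (fun x : ℝ => (z - (x : ℂ)) ^ (β : ℂ)) ν :=
  Integrable.mono' ((integrable_const (1 + ‖z‖)).add hν)
    (measurable_sub_cpow z β).aestronglyMeasurable
    (Eventually.of_forall fun x => norm_sub_cpow_le_of_pos hβ0 hβ1 z x)

/-- All `z - x` have the same imaginary part, so their arguments stay in `[0, π]` or in `(-π, 0)`;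
`θ` is the midpoint. -/
theorem exists_abs_arg_sub_le (z : ℂ) : ∃ θ : ℝ, ∀ x : ℝ, |Complex.arg (z - x) - θ| ≤ Real.pi / 2 := by
  rcases le_or_gt 0 z.im with h | h
  · refine ⟨Real.pi / 2, fun x => ?_⟩
    have h1 : 0 ≤ Complex.arg (z - x) := Complex.arg_nonneg_iff.2 (by simpa using h)
    have h2 := Complex.arg_le_pi (z - x)
    rw [abs_le]
    constructor <;> linarith
  · refine ⟨-(Real.pi / 2), fun x => ?_⟩
    have h1 : Complex.arg (z - x) < 0 := Complex.arg_neg_iff.2 (by simpa using h)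
    have h2 := Complex.neg_pi_lt_arg (z - x)
    rw [abs_le]
    constructor <;> linarith

/-- After rotation by `-β θ` the integrand has argument at most `β π / 2 < π / 2` in absolute value,
hence positive real part for `ν`-almost every `x`; such an integral cannot vanish. -/
theorem powerIntegral_ne_zero {ν : Measure ℝ} [IsProbabilityMeasure ν]
    (hν : Integrable (fun x : ℝ => |x|) ν) {β : ℝ} (hβ0 : 0 < β) (hβ1 : β < 1) {z : ℂ}
    (hz : z ∉ supportHull ν) : powerIntegral ν β z ≠ 0 := by
  obtain ⟨θ, hθ⟩ := exists_abs_arg_sub_le z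
  obtain ⟨d, hd, hdz⟩ := exists_le_norm_sub_of_notMem_supportHull hz
  have hint := (integrable_sub_cpow_pos hν hβ0 hβ1 z).const_mul
    (Complex.exp (-(β * θ : ℝ) * Complex.I))
  have hre : ∀ x : ℝ, z - x ≠ 0 → 0 <
      (Complex.exp (-(β * θ : ℝ) * Complex.I) * (z - (x : ℂ)) ^ (β : ℂ)).re := by
    intro x hx
    rw [Complex.cpow_def_of_ne_zero hx, ← Complex.exp_add, Complex.exp_re]
    refine mul_pos (Real.exp_pos _) (Real.cos_pos_of_mem_Ioo ?_)
    have e : (-((β * θ : ℝ) : ℂ) * Complex.I + Complex.log (z - x) * β).im =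
        β * (Complex.arg (z - x) - θ) := by
      simp [Complex.log_im]
      ring
    rw [e]
    have h1 := abs_le.1 (hθ x)
    have hpi := Real.pi_pos
    constructor <;> nlinarith
  intro h0
  have h1 : ∫ x : ℝ, (Complex.exp (-(β * θ : ℝ) * Complex.I) * (z - (x : ℂ)) ^ (β : ℂ)).re ∂ν = 0 := by
    have := integral_re hint
    simp only [RCLike.re_to_complex] at this
    rw [this, integral_const_mul]
    unfold powerIntegral at h0
    rw [h0]
    simp
  have hpos : ∀ᵐ x : ℝ ∂ν, 0 <
      (Complex.exp (-(β * θ : ℝ) * Complex.I) * (z - (x : ℂ)) ^ (β : ℂ)).re := by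
    filter_upwards [ae_mem_convexHull_support ν] with x hx
    exact hre x fun h => by
      have := hdz x hx
      rw [h, norm_zero] at this
      linarith
  have h2 := (integral_eq_zero_iff_of_nonneg_ae (hpos.mono fun x hx => hx.le) hint.re).1 h1
  have h3 : ∀ᵐ x ∂ν, False := by
    filter_upwards [hpos, h2] with x hx1 hx2
    simp only [Pi.zero_apply] at hx2
    exact absurd hx2 hx1.ne'
  exact IsProbabilityMeasure.ne_zero ν (by simpa using h3)

/-- On the negative axis the principal branch uses argument `π`, the limit from above. Approaching
through the closed upper half-plane therefore gives the right value even for real `z` to the left of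
the hull. -/
theorem continuousWithinAt_cpow_upper (s : ℝ) {w : ℂ} (hw : w ≠ 0) (him : w.im = 0) :
    ContinuousWithinAt (fun v : ℂ => v ^ (s : ℂ)) {v : ℂ | 0 ≤ v.im} w := by
  have hlog : ContinuousWithinAt Complex.log {v : ℂ | 0 ≤ v.im} w := by
    rcases lt_trichotomy w.re 0 with h | h | h
    · exact Complex.continuousWithinAt_log_of_re_neg_of_im_zero h him
    · exact absurd (Complex.ext h him) hw
    · exact (continuousAt_clog (Complex.mem_slitPlane_iff.2 (Or.inl h))).continuousWithinAt
  have h1 : ContinuousWithinAt (fun v : ℂ => Complex.exp (Complex.log v * s))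
      {v : ℂ | 0 ≤ v.im} w := (hlog.mul continuousWithinAt_const).cexp
  refine h1.congr_of_eventuallyEq ?_ (Complex.cpow_def_of_ne_zero hw _)
  filter_upwards [nhdsWithin_le_nhds (isOpen_ne.mem_nhds hw)] with v hv
  exact Complex.cpow_def_of_ne_zero hv _

/-- Supplies a lower bound on the distance to the hull that is uniform in `η`, for domination as `η`
tends to `0`. -/
theorem norm_sub_le_norm_add_mul_I_sub {z : ℂ} (him : z.im = 0) (η x : ℝ) :
    ‖z - (x : ℂ)‖ ≤ ‖z + η * Complex.I - (x : ℂ)‖ := by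
  have hzre : (z.re : ℂ) = z := by
    apply Complex.ext <;> simp [him]
  have h1 : ‖z - (x : ℂ)‖ = |z.re - x| := by
    rw [← hzre, ← Complex.ofReal_sub, Complex.norm_real]
    simp
  rw [h1]
  simpa using Complex.abs_re_le_norm (z + η * Complex.I - (x : ℂ))

theorem tendsto_add_mul_I (z : ℂ) :
    Tendsto (fun η : ℝ => z + η * Complex.I) (𝓝[>] 0) (𝓝 z) := by
  have h : Continuous fun η : ℝ => z + η * Complex.I := by fun_prop
  have := h.tendsto 0
  simp only [Complex.ofReal_zero, zero_mul, add_zero] at this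
  exact this.mono_left nhdsWithin_le_nhds

theorem tendsto_powerIntegral_real {ν : Measure ℝ} [IsProbabilityMeasure ν] {z : ℂ}
    (him : z.im = 0) (hz : z ∉ supportHull ν) (s : ℝ) {b : ℝ → ℝ} (hb : Integrable b ν)
    (hbound : ∀ η : ℝ, 0 < η → η ≤ 1 → ∀ x ∈ convexHull ℝ ν.support,
      ‖(z + η * Complex.I - (x : ℂ)) ^ (s : ℂ)‖ ≤ b x) :
    Tendsto (fun η : ℝ => powerIntegral ν s (z + η * Complex.I)) (𝓝[>] 0)
      (𝓝 (powerIntegral ν s z)) := by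
  obtain ⟨d, hd, hdz⟩ := exists_le_norm_sub_of_notMem_supportHull hz
  refine tendsto_integral_filter_of_dominated_convergence b
    (Eventually.of_forall fun η => (measurable_sub_cpow _ s).aestronglyMeasurable) ?_ hb ?_
  · filter_upwards [self_mem_nhdsWithin,
      nhdsWithin_le_nhds (Iic_mem_nhds (one_pos : (0 : ℝ) < 1))] with η h1 h2
    filter_upwards [ae_mem_convexHull_support ν] with x hx
    exact hbound η h1 h2 x hx
  · filter_upwards [ae_mem_convexHull_support ν] with x hx
    have hne : z - (x : ℂ) ≠ 0 := fun h => by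
      have := hdz x hx
      rw [h, norm_zero] at this
      linarith
    have h1 := continuousWithinAt_cpow_upper s hne (by simpa using him)
    refine Tendsto.comp (f := fun η : ℝ => z + η * Complex.I - (x : ℂ)) h1
      (tendsto_nhdsWithin_iff.2 ⟨(tendsto_add_mul_I z).sub_const _, ?_⟩)
    filter_upwards [self_mem_nhdsWithin] with η hη
    have : 0 < η := hη
    simpa [him] using this.le

theorem tendsto_stieltjesTransform_real {μ ν : Measure ℝ} [IsProbabilityMeasure μ] {z : ℂ}
    (him : z.im = 0) (hz : z ∉ supportHull ν) (hμ : ∀ᵐ x ∂μ, x ∈ convexHull ℝ ν.support) :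
    Tendsto (fun η : ℝ => stieltjesTransform μ (z + η * Complex.I)) (𝓝[>] 0)
      (𝓝 (stieltjesTransform μ z)) := by
  obtain ⟨d, hd, hdz⟩ := exists_le_norm_sub_of_notMem_supportHull hz
  refine tendsto_integral_filter_of_dominated_convergence (fun _ => d⁻¹)
    (Eventually.of_forall fun η => Measurable.aestronglyMeasurable (by fun_prop)) ?_
    (integrable_const _) ?_
  · refine Eventually.of_forall fun η => ?_
    filter_upwards [hμ] with x hx
    rw [norm_div, norm_one, one_div, norm_sub_rev]
    exact inv_anti₀ hd ((hdz x hx).trans (norm_sub_le_norm_add_mul_I_sub him η x))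
  · filter_upwards [hμ] with x hx
    have hne : (x : ℂ) - z ≠ 0 := fun h => by
      have := hdz x hx
      rw [norm_sub_rev, h, norm_zero] at this
      linarith
    exact Tendsto.div tendsto_const_nhds ((tendsto_add_mul_I z).const_sub _) hne

theorem notMem_supportHull_of_im_ne_zero {ν : Measure ℝ} {z : ℂ} (hz : z.im ≠ 0) :
    z ∉ supportHull ν := by
  rintro ⟨x, _, rfl⟩
  simp at hz

/-- The formula for the Stieltjes transform off the real axis extends to the real points outside
the hull. -/
theorem hasLimitStieltjes_of_im_ne_zero {α : ℝ} (hα0 : 0 < α) (hα2 : α < 2) {μ ν : Measure ℝ}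
    [IsProbabilityMeasure μ] [IsProbabilityMeasure ν] (hν : Integrable (fun x : ℝ => |x|) ν)
    (hμ : ∀ᵐ x ∂μ, x ∈ convexHull ℝ ν.support)
    (h : ∀ z : ℂ, z.im ≠ 0 → stieltjesTransform μ z =
      -(powerIntegral ν (α / 2 - 1) z / powerIntegral ν (α / 2) z)) :
    HasLimitStieltjes α ν μ := by
  intro z hz
  by_cases him : z.im = 0
  · obtain ⟨d, hd, hdz⟩ := exists_le_norm_sub_of_notMem_supportHull hz
    have h1 := tendsto_stieltjesTransform_real him hz hμ
    have h2 := tendsto_powerIntegral_real him hz (α / 2 - 1) (integrable_const (d ^ (α / 2 - 1)))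
      (fun η _ _ x hx => norm_cpow_le_of_le hd (by linarith)
        ((hdz x hx).trans (norm_sub_le_norm_add_mul_I_sub him η x)))
    have h3 := tendsto_powerIntegral_real him hz (α / 2)
      ((integrable_const (1 + (‖z‖ + 1))).add hν) (fun η h0 h1 x _ => by
        refine (norm_sub_cpow_le_of_pos (by linarith) (by linarith) _ x).trans ?_
        have : ‖z + η * Complex.I‖ ≤ ‖z‖ + 1 := by
          refine (norm_add_le _ _).trans ?_
          gcongr
          simpa [abs_of_pos h0] using h1
        simp only [Pi.add_apply]
        linarith)
    have h4 := (h2.div h3 (powerIntegral_ne_zero hν (by linarith) (by linarith) hz)).neg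
    refine tendsto_nhds_unique h1 (h4.congr' ?_)
    filter_upwards [self_mem_nhdsWithin] with η hη
    have hη : 0 < η := hη
    exact (h _ (by simpa [him] using hη.ne')).symm
  · exact h z him

/-! ### The self-normalized form and its moments -/

/-- The form `∑ a i * y i ^ 2`. -/
noncomputable def sqForm {n : ℕ} (y a : Fin n → ℝ) : ℝ := ∑ i, a i * y i ^ 2

theorem measurable_sqForm {n : ℕ} :
    Measurable fun p : (Fin n → ℝ) × (Fin n → ℝ) => sqForm p.1 p.2 := by
  unfold sqForm; fun_prop

theorem diagQuadForm_eq_sqForm {n : ℕ} (y : Fin n → ℝ) (A : Matrix (Fin n) (Fin n) ℂ) :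
    diagQuadForm y A = sqForm y (realDiag A) := by
  simp only [diagQuadForm, quadForm, sqForm, realDiag, dotProduct, Matrix.mulVec_diagonal,
    Complex.re_sum]
  refine Finset.sum_congr rfl fun i _ => ?_
  simp [Matrix.diag]
  ring

theorem selfNormalize_sq {n : ℕ} (x : Fin n → ℝ) (i : Fin n) :
    selfNormalize x i ^ 2 = x i ^ 2 / ∑ j, x j ^ 2 := by
  rw [selfNormalize, div_pow, Real.sq_sqrt (Finset.sum_nonneg fun j _ => sq_nonneg _)]

/-- Also true when the sum vanishes, since then every `x i` is `0`. The identity `W * S = R` thus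
holds at every sample point, with no exceptional event. -/
theorem selfNormalize_sq_mul_sum {n : ℕ} (x : Fin n → ℝ) (i : Fin n) :
    selfNormalize x i ^ 2 * ∑ j, x j ^ 2 = x i ^ 2 := by
  rw [selfNormalize_sq]
  by_cases h : ∑ j, x j ^ 2 = 0
  · rw [h, mul_zero]
    exact ((Finset.sum_eq_zero_iff_of_nonneg fun j _ => sq_nonneg (x j)).1 h i
      (Finset.mem_univ i)).symm
  · rw [div_mul_cancel₀ _ h]

theorem sum_selfNormalize_sq_le_one {n : ℕ} (x : Fin n → ℝ) :
    ∑ i, selfNormalize x i ^ 2 ≤ 1 := by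
  simp only [selfNormalize_sq, ← Finset.sum_div]
  exact div_self_le_one _

theorem sum_selfNormalize_sq_eq_one {n : ℕ} {x : Fin n → ℝ} (h : ∑ j, x j ^ 2 ≠ 0) :
    ∑ i, selfNormalize x i ^ 2 = 1 := by
  simp only [selfNormalize_sq, ← Finset.sum_div]
  exact div_self h

theorem measurable_selfNormalize {n : ℕ} :
    Measurable (selfNormalize : (Fin n → ℝ) → Fin n → ℝ) := by
  unfold selfNormalize; fun_prop

theorem abs_sqForm_le {n : ℕ} (y b : Fin n → ℝ) :
    |sqForm y b| ≤ sqForm y fun i => |b i| := by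
  refine (Finset.abs_sum_le_sum_abs _ _).trans (le_of_eq (Finset.sum_congr rfl fun i _ => ?_))
  rw [abs_mul, abs_of_nonneg (sq_nonneg (y i))]

theorem sqForm_sub {n : ℕ} (y b c : Fin n → ℝ) :
    sqForm y b - sqForm y c = sqForm y fun i => b i - c i := by
  simp only [sqForm, ← Finset.sum_sub_distrib, sub_mul]

theorem sqForm_mono {n : ℕ} (y : Fin n → ℝ) {b c : Fin n → ℝ} (h : ∀ i, b i ≤ c i) :
    sqForm y b ≤ sqForm y c :=
  Finset.sum_le_sum fun i _ => mul_le_mul_of_nonneg_right (h i) (sq_nonneg _)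

theorem abs_sqForm_selfNormalize_le {n : ℕ} (x b : Fin n → ℝ) {T : ℝ} (hT : 0 ≤ T)
    (hb : ∀ i, |b i| ≤ T) : |sqForm (selfNormalize x) b| ≤ T := by
  refine (abs_sqForm_le _ _).trans ((sqForm_mono _ hb).trans ?_)
  rw [sqForm, ← Finset.mul_sum]
  have := sum_selfNormalize_sq_le_one x
  nlinarith

section Moments

variable {Ω : Type*} [MeasurableSpace Ω] {P : Measure Ω} {X : ℕ → Ω → ℝ}

/-- Exchangeability: swapping two coordinates preserves the joint law and leaves the normalizing sum
unchanged. -/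
theorem integral_selfNormalizedVector_sq_eq (hXi : iIndepFun X P)
    (hXid : ∀ j, IdentDistrib (X j) (X 0) P P) {n : ℕ} (i k : Fin n) :
    ∫ ω, selfNormalizedVector X n ω i ^ 2 ∂P = ∫ ω, selfNormalizedVector X n ω k ^ 2 ∂P := by
  set σ : Equiv.Perm (Fin n) := Equiv.swap i k
  have h1 : iIndepFun (fun j : Fin n => X j) P := hXi.precomp Fin.val_injective
  have h2 : iIndepFun (fun j : Fin n => X (σ j)) P :=
    hXi.precomp (g := fun j : Fin n => (σ j : ℕ)) (Fin.val_injective.comp σ.injective)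
  have h3 := IdentDistrib.pi (fun j : Fin n => (hXid j).trans (hXid (σ j)).symm) h1 h2
  have h4 := (h3.comp (u := fun x : Fin n → ℝ => selfNormalize x i ^ 2)
    (((measurable_pi_apply i).comp measurable_selfNormalize).pow_const 2)).integral_eq
  refine h4.trans (integral_congr_ae (Eventually.of_forall fun ω => ?_))
  simp only [Function.comp_apply, selfNormalizedVector, selfNormalize_sq]
  rw [Equiv.sum_comp σ fun j : Fin n => X j ω ^ 2, Equiv.swap_apply_left]

theorem regVar_sq {α : ℝ} (hX : RegularlyVaryingTail P (X 0) α) :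
    RegVar (fun x => P.real {ω | x < X 0 ω ^ 2}) (α / 2) := by
  obtain ⟨L, ⟨hL0, hL⟩, hP⟩ := hX
  have hset : ∀ x : ℝ, 0 < x → P.real {ω | x < X 0 ω ^ 2} = √x ^ (-α) * L √x := by
    intro x hx
    rw [← hP _ (Real.sqrt_pos.2 hx)]
    congr 1
    ext ω
    simp only [Set.mem_ofPred_eq]
    rw [← Real.sqrt_sq_eq_abs, Real.sqrt_lt_sqrt_iff hx.le]
  constructor
  · intro x hx
    simp only [hset x hx]
    have := hL0 _ (Real.sqrt_pos.2 hx)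
    have := Real.sqrt_pos.2 hx
    positivity
  · intro u hu
    have hu' := Real.sqrt_pos.2 hu
    have h1 := ((hL √u hu').comp Real.tendsto_sqrt_atTop).const_mul (u ^ (-(α / 2)))
    rw [mul_one] at h1
    refine h1.congr' ?_
    filter_upwards [eventually_gt_atTop 0] with x hx
    have hx' := Real.sqrt_pos.2 hx
    rw [hset _ (mul_pos hu hx), hset x hx, Real.sqrt_mul hu.le, Real.mul_rpow hu'.le hx'.le]
    have e : √u ^ (-α) = u ^ (-(α / 2)) := by
      rw [Real.sqrt_eq_rpow, ← Real.rpow_mul hu.le]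
      congr 1; ring
    rw [e]
    have : 0 < √x ^ (-α) := by positivity
    have := hL0 _ hx'
    simp only [Function.comp_apply]
    field_simp

variable [IsProbabilityMeasure P]

theorem measurable_selfNormalizedVector (hXm : ∀ j, Measurable (X j)) (n : ℕ) :
    Measurable (selfNormalizedVector X n) :=
  measurable_selfNormalize.comp (measurable_pi_lambda _ fun i => hXm i)

theorem integrable_selfNormalizedVector_sq (hXm : ∀ j, Measurable (X j)) {n : ℕ} (i : Fin n) :
    Integrable (fun ω => selfNormalizedVector X n ω i ^ 2) P := by
  refine Integrable.of_bound (C := 1) (Measurable.aestronglyMeasurable ?_)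
    (Eventually.of_forall fun ω => ?_)
  · exact ((measurable_pi_apply i).comp (measurable_selfNormalizedVector hXm n)).pow_const 2
  · rw [Real.norm_of_nonneg (sq_nonneg _)]
    exact (Finset.single_le_sum (f := fun i => selfNormalizedVector X n ω i ^ 2)
      (fun j _ => sq_nonneg _) (Finset.mem_univ i)).trans (sum_selfNormalize_sq_le_one _)

theorem integral_selfNormalizedVector_sq_le (hXm : ∀ j, Measurable (X j)) (hXi : iIndepFun X P)
    (hXid : ∀ j, IdentDistrib (X j) (X 0) P P) {n : ℕ} (i : Fin n) :
    ∫ ω, selfNormalizedVector X n ω i ^ 2 ∂P ≤ (n : ℝ)⁻¹ := by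
  have hn : (0 : ℝ) < n := by exact_mod_cast i.pos
  have h1 : ∑ k : Fin n, ∫ ω, selfNormalizedVector X n ω k ^ 2 ∂P ≤ 1 := by
    rw [← integral_finsetSum _ fun k _ => integrable_selfNormalizedVector_sq hXm k]
    have := integral_mono (μ := P) (integrable_finsetSum Finset.univ fun k _ =>
      integrable_selfNormalizedVector_sq (P := P) hXm k) (integrable_const (1 : ℝ))
      fun ω => sum_selfNormalize_sq_le_one (fun i : Fin n => X i ω)
    simpa using this
  simp only [fun k => integral_selfNormalizedVector_sq_eq hXi hXid k i] at h1
  rw [Finset.sum_const, Finset.card_univ, Fintype.card_fin, nsmul_eq_mul] at h1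
  rw [← one_div, le_div_iff₀ hn]
  linarith

theorem integrable_sqForm (hXm : ∀ j, Measurable (X j)) {n : ℕ} (b : Fin n → ℝ) :
    Integrable (fun ω => sqForm (selfNormalizedVector X n ω) b) P :=
  integrable_finsetSum _ fun i _ => (integrable_selfNormalizedVector_sq hXm i).const_mul _

/-- The `n` equal second moments add up to at most `1`, so each is at most `1 / n`. This converts
hypotheses on averages of the diagonal into `L¹` bounds on the form. -/
theorem integral_sqForm_le (hXm : ∀ j, Measurable (X j)) (hXi : iIndepFun X P)
    (hXid : ∀ j, IdentDistrib (X j) (X 0) P P) {n : ℕ} {b : Fin n → ℝ} (hb : ∀ i, 0 ≤ b i) :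
    ∫ ω, sqForm (selfNormalizedVector X n ω) b ∂P ≤ (n : ℝ)⁻¹ * ∑ i, b i := by
  unfold sqForm
  rw [integral_finsetSum _ fun i _ => (integrable_selfNormalizedVector_sq hXm i).const_mul _,
    Finset.mul_sum]
  refine Finset.sum_le_sum fun i _ => ?_
  rw [integral_const_mul, mul_comm]
  exact mul_le_mul_of_nonneg_right (integral_selfNormalizedVector_sq_le hXm hXi hXid i) (hb i)

theorem measurable_sqForm_selfNormalizedVector (hXm : ∀ j, Measurable (X j)) {n : ℕ}
    (b : Fin n → ℝ) : Measurable fun ω => sqForm (selfNormalizedVector X n ω) b :=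
  measurable_sqForm.comp ((measurable_selfNormalizedVector hXm n).prodMk measurable_const)

/-- The indicator of the event is at most `exp (-∑ X i ^ 2)`, whose mean is `q ^ n` with `q < 1`. -/
theorem tendsto_measureReal_sum_sq_eq_zero (hXm : ∀ j, Measurable (X j)) (hXi : iIndepFun X P)
    (hXid : ∀ j, IdentDistrib (X j) (X 0) P P) (hpos : 0 < P.real {ω | 1 < X 0 ω ^ 2}) :
    Tendsto (fun n : ℕ => P.real {ω | ∑ i : Fin n, X i ω ^ 2 = 0}) atTop (𝓝 0) := by
  set q : ℝ := ∫ ω, Real.exp (-(1 * X 0 ω ^ 2)) ∂P with hq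
  have hm : Measurable fun ω => X 0 ω ^ 2 := (hXm 0).pow_const 2
  have hexp : Integrable (fun ω => Real.exp (-(1 * X 0 ω ^ 2))) P :=
    Integrable.of_bound (C := 1) (Measurable.aestronglyMeasurable (by fun_prop))
      (Eventually.of_forall fun ω => by
        rw [Real.norm_eq_abs, Real.abs_exp]
        exact Real.exp_le_one_iff.2 (by nlinarith [sq_nonneg (X 0 ω)]))
  have hq0 : 0 ≤ q := integral_nonneg fun ω => (Real.exp_pos _).le
  have hq1 : q < 1 := by
    have := integral_one_sub_exp_pos (P := P) hm (fun ω => sq_nonneg _) hpos one_pos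
    rw [integral_sub (integrable_const _) hexp] at this
    simp only [integral_const, probReal_univ, smul_eq_mul, mul_one] at this
    linarith
  refine squeeze_zero (fun n => measureReal_nonneg) (fun n => ?_)
    (tendsto_pow_atTop_nhds_zero_of_lt_one hq0 hq1)
  have h1 := integral_exp_neg_sum (P := P) (V := fun j ω => X j ω ^ 2)
    (fun j => (hXm j).pow_const 2)
    (hXi.comp (fun _ x => x ^ 2) fun _ => by fun_prop)
    (fun j => (hXid j).comp (u := fun x => x ^ 2) (by fun_prop)) (n := n) (fun _ => 1)
  rw [Finset.prod_const, Finset.card_univ, Fintype.card_fin] at h1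
  rw [← h1]
  have hms : MeasurableSet {ω | ∑ i : Fin n, X i ω ^ 2 = 0} :=
    (Finset.measurable_sum Finset.univ fun (i : Fin n) _ => (hXm i).pow_const 2)
      (measurableSet_singleton 0)
  rw [← integral_indicator_one hms]
  have hnn : ∀ ω, 0 ≤ ∑ i : Fin n, 1 * X i ω ^ 2 := fun ω =>
    Finset.sum_nonneg fun i _ => by positivity
  refine integral_mono ((integrable_const 1).indicator hms) ?_ fun ω => ?_
  · refine Integrable.of_bound (C := 1) (Measurable.aestronglyMeasurable ?_)
      (Eventually.of_forall fun ω => ?_)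
    · have := hXm
      fun_prop
    · rw [Real.norm_eq_abs, Real.abs_exp]
      exact Real.exp_le_one_iff.2 (by linarith [hnn ω])
  · simp only
    by_cases hω : ω ∈ {ω | ∑ i : Fin n, X i ω ^ 2 = 0}
    · rw [Set.indicator_of_mem hω]
      have : ∑ i : Fin n, X i ω ^ 2 = 0 := hω
      simp [this]
    · rw [Set.indicator_of_notMem hω]
      positivity

end Moments

/-! ### Tightness and the continuity theorem for Cauchy transforms -/

section Laws

variable {Ω : Type*} [MeasurableSpace Ω] {P : Measure Ω} [IsProbabilityMeasure P]
  {Y : ℕ → Ω → ℝ}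

/-- The law of `Y`, as a probability measure. -/
noncomputable def law (P : Measure Ω) [IsProbabilityMeasure P] {Y : Ω → ℝ} (hY : Measurable Y) :
    ProbabilityMeasure ℝ :=
  ⟨P.map Y, Measure.isProbabilityMeasure_map hY.aemeasurable⟩

theorem tendsto_integral_of_tendsto_law {𝕜 : Type*} [RCLike 𝕜] (hY : ∀ n, Measurable (Y n))
    {κ : ℕ → ℕ} {μ : ProbabilityMeasure ℝ}
    (h : Tendsto (fun k => law P (hY (κ k))) atTop (𝓝 μ)) {g : ℝ → 𝕜} (hg : Continuous g)
    {C : ℝ} (hC : ∀ x, ‖g x‖ ≤ C) :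
    Tendsto (fun k => ∫ ω, g (Y (κ k) ω) ∂P) atTop (𝓝 (∫ x, g x ∂(μ : Measure ℝ))) := by
  have h1 := (ProbabilityMeasure.tendsto_iff_forall_integral_rclike_tendsto 𝕜).1 h
    (BoundedContinuousFunction.ofNormedAddCommGroup g hg C hC)
  refine h1.congr fun k => ?_
  exact integral_map (hY (κ k)).aemeasurable hg.aestronglyMeasurable

/-- Markov's inequality gives tightness from bounded first absolute moments, and Prokhorov's theorem
gives the subsequence. -/
theorem exists_subseq_tendsto_law (hY : ∀ n, Measurable (Y n)) (hint : ∀ n, Integrable (Y n) P)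
    {C : ℝ} (hC : ∀ᶠ n in atTop, ∫ ω, |Y n ω| ∂P ≤ C) (ns : ℕ → ℕ) :
    ∃ (μ : ProbabilityMeasure ℝ) (ms : ℕ → ℕ), StrictMono ms ∧
      Tendsto (fun k => law P (hY (ns (ms k)))) atTop (𝓝 μ) := by
  have htight : IsTightMeasureSet (Set.range fun n => P.map (Y n)) := by
    have : ∀ n, IsProbabilityMeasure (P.map (Y n)) := fun n =>
      Measure.isProbabilityMeasure_map (hY n).aemeasurable
    refine isTightMeasureSet_range_of_tendsto_limsup_measure_norm_gt ?_
    have hlim : Tendsto (fun r : ℝ => ENNReal.ofReal (C / r)) atTop (𝓝 0) := by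
      have := ENNReal.tendsto_ofReal (tendsto_const_nhds.div_atTop tendsto_id :
        Tendsto (fun r : ℝ => C / r) atTop (𝓝 0))
      simpa using this
    refine tendsto_of_tendsto_of_tendsto_of_le_of_le' tendsto_const_nhds hlim
      (Eventually.of_forall fun _ => zero_le) ?_
    filter_upwards [eventually_gt_atTop 0] with r hr
    refine limsup_le_of_le (by isBoundedDefault) ?_
    filter_upwards [hC] with n hn
    rw [Measure.map_apply (hY n) (measurableSet_lt measurable_const measurable_norm)]
    have h1 := mul_meas_ge_le_integral_of_nonneg (μ := P)
      (Eventually.of_forall fun ω => abs_nonneg (Y n ω)) (hint n).abs r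
    have h2 : P.real {ω | r ≤ |Y n ω|} ≤ C / r := by
      rw [le_div_iff₀ hr]
      linarith
    calc P ((Y n) ⁻¹' {x | r < ‖x‖}) ≤ P {ω | r ≤ |Y n ω|} :=
          measure_mono fun ω hω => le_of_lt (by simpa using hω)
      _ = ENNReal.ofReal (P.real {ω | r ≤ |Y n ω|}) := (ofReal_measureReal).symm
      _ ≤ ENNReal.ofReal (C / r) := ENNReal.ofReal_le_ofReal h2
  have hcomp : IsCompact (closure (Set.range fun n => law P (hY n))) := by
    refine isCompact_closure_of_isTightMeasureSet (htight.subset ?_)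
    rintro _ ⟨_, ⟨n, rfl⟩, rfl⟩
    exact ⟨n, rfl⟩
  obtain ⟨μ, -, ms, hms, hlim⟩ := hcomp.isSeqCompact
    (x := fun k => law P (hY (ns k))) fun k => subset_closure ⟨ns k, rfl⟩
  exact ⟨μ, ms, hms, hlim⟩

theorem continuous_inv_sub {w : ℂ} (hw : w.im ≠ 0) : Continuous fun x : ℝ => (w - (x : ℂ))⁻¹ := by
  refine Continuous.inv₀ (by fun_prop) fun x h => ?_
  have := abs_im_le_norm_sub_ofReal w x
  rw [h, norm_zero] at this
  exact (abs_pos.2 hw).not_ge this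

theorem norm_inv_sub_le {w : ℂ} (hw : w.im ≠ 0) (x : ℝ) : ‖(w - (x : ℂ))⁻¹‖ ≤ |w.im|⁻¹ := by
  rw [norm_inv]
  exact inv_anti₀ (abs_pos.2 hw) (abs_im_le_norm_sub_ofReal w x)

theorem stieltjesTransform_eq_neg (μ : Measure ℝ) (z : ℂ) :
    stieltjesTransform μ z = -∫ x : ℝ, (z - (x : ℂ))⁻¹ ∂μ := by
  rw [stieltjesTransform, ← integral_neg]
  refine integral_congr_ae (Eventually.of_forall fun x => ?_)
  simp only
  rw [one_div, ← inv_neg, neg_sub]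

/-- Continuity theorem for Cauchy transforms of a tight sequence of laws. -/
theorem exists_tendsto_law_of_cauchy (hY : ∀ n, Measurable (Y n)) (hint : ∀ n, Integrable (Y n) P)
    {C : ℝ} (hC : ∀ᶠ n in atTop, ∫ ω, |Y n ω| ∂P ≤ C) {Ψ : ℂ → ℂ}
    (hΨ : ∀ w : ℂ, w.im ≠ 0 → Tendsto (fun n => ∫ ω, (w - (Y n ω : ℂ))⁻¹ ∂P) atTop (𝓝 (Ψ w))) :
    ∃ μ : ProbabilityMeasure ℝ, Tendsto (fun n => law P (hY n)) atTop (𝓝 μ) ∧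
      ∀ w : ℂ, w.im ≠ 0 → ∫ x : ℝ, (w - (x : ℂ))⁻¹ ∂(μ : Measure ℝ) = Ψ w := by
  have hsub : ∀ (κ : ℕ → ℕ), Tendsto κ atTop atTop → ∀ μ : ProbabilityMeasure ℝ,
      Tendsto (fun k => law P (hY (κ k))) atTop (𝓝 μ) →
      ∀ w : ℂ, w.im ≠ 0 → ∫ x : ℝ, (w - (x : ℂ))⁻¹ ∂(μ : Measure ℝ) = Ψ w := by
    intro κ hκ μ hμ w hw
    exact tendsto_nhds_unique (tendsto_integral_of_tendsto_law hY hμ (continuous_inv_sub hw)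
      (norm_inv_sub_le hw)) ((hΨ w hw).comp hκ)
  obtain ⟨μ, ms, hms, hμ⟩ := exists_subseq_tendsto_law hY hint hC id
  have hμΨ := hsub ms hms.tendsto_atTop μ hμ
  refine ⟨μ, tendsto_of_subseq_tendsto fun ns hns => ?_, hμΨ⟩
  obtain ⟨μ', ms', hms', hμ'⟩ := exists_subseq_tendsto_law hY hint hC ns
  have hμ'Ψ := hsub _ (hns.comp hms'.tendsto_atTop) μ' hμ'
  have heq : (μ' : Measure ℝ) = μ := eq_of_stieltjesTransform_eq fun z hz => by
    rw [stieltjesTransform_eq_neg, stieltjesTransform_eq_neg, hμΨ z hz.ne', hμ'Ψ z hz.ne']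
  have heq' : μ' = μ := Subtype.ext heq
  exact ⟨ms', heq' ▸ hμ'⟩

end Laws

/-! ### Uniformly integrable arrays -/

/-- Uniform integrability of the rows of a triangular array. -/
def UnifTail (a : (n : ℕ) → Fin n → ℝ) : Prop :=
  ∀ ε : ℝ, 0 < ε → ∀ᶠ T : ℝ in atTop, ∀ᶠ n : ℕ in atTop, tailAverage (a n) T < ε

theorem avg_mono {n : ℕ} {b c : Fin n → ℝ} (h : ∀ i, b i ≤ c i) :
    (n : ℝ)⁻¹ * ∑ i, b i ≤ (n : ℝ)⁻¹ * ∑ i, c i :=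
  mul_le_mul_of_nonneg_left (Finset.sum_le_sum fun i _ => h i) (by positivity)

theorem avg_const_le {n : ℕ} {c : ℝ} (hc : 0 ≤ c) : (n : ℝ)⁻¹ * ∑ _i : Fin n, c ≤ c :=
  (le_abs_self _).trans (abs_avg_le hc fun _ => (abs_of_nonneg hc).le)

theorem abs_le_add_indicator (T x : ℝ) (hT : 0 ≤ T) :
    |x| ≤ T + Set.indicator {x : ℝ | T < |x|} (fun x => |x|) x := by
  by_cases h : T < |x|
  · rw [Set.indicator_of_mem (by exact h)]
    linarith
  · rw [Set.indicator_of_notMem (by exact h)]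
    linarith [not_lt.1 h]

theorem UnifTail.exists_avg_abs_le {a : (n : ℕ) → Fin n → ℝ} (ha : UnifTail a) :
    ∃ C : ℝ, ∀ᶠ n : ℕ in atTop, (n : ℝ)⁻¹ * ∑ i, |a n i| ≤ C := by
  obtain ⟨T, hT, hT0⟩ := ((ha 1 one_pos).and (eventually_ge_atTop 0)).exists
  refine ⟨T + 1, ?_⟩
  filter_upwards [hT] with n hn
  refine (avg_mono fun i => abs_le_add_indicator T (a n i) hT0).trans ?_
  rw [Finset.sum_add_distrib, mul_add]
  have h1 := avg_const_le (n := n) hT0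
  unfold tailAverage at hn
  linarith

/-- The averages of `min |x| N` have a bound independent of `N`; it passes to `ν` by weak
convergence and then to `|x|` by Fatou. -/
theorem integrable_abs_of_unifTail {a : (n : ℕ) → Fin n → ℝ} {ν : Measure ℝ}
    [IsProbabilityMeasure ν] (hw : WeakAvg a ν) (ha : UnifTail a) :
    Integrable (fun x : ℝ => |x|) ν := by
  obtain ⟨C, hC⟩ := ha.exists_avg_abs_le
  have hbd : ∀ N : ℕ, ∫ x, min |x| N ∂ν ≤ C := by
    intro N
    refine le_of_tendsto (hw (fun x => min |x| N) (by fun_prop) ⟨N, fun x => ?_⟩) ?_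
    · rw [abs_of_nonneg (by positivity)]
      exact min_le_right _ _
    · filter_upwards [hC] with n hn
      exact (avg_mono fun i => min_le_left _ _).trans hn
  refine ⟨Measurable.aestronglyMeasurable (by fun_prop), ?_⟩
  have hlim : ∀ x : ℝ, Tendsto (fun N : ℕ => ENNReal.ofReal (min |x| N)) atTop (𝓝 ‖|x|‖ₑ) := by
    intro x
    refine tendsto_const_nhds.congr' ?_
    filter_upwards [tendsto_natCast_atTop_atTop.eventually (eventually_ge_atTop |x|)] with N hN
    rw [min_eq_left hN, Real.enorm_eq_ofReal (abs_nonneg x)]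
  have hfatou := lintegral_liminf_le (μ := ν) (u := atTop)
    (f := fun (N : ℕ) (x : ℝ) => ENNReal.ofReal (min |x| N)) (fun N => by fun_prop)
  simp only [fun x => (hlim x).liminf_eq] at hfatou
  refine lt_of_le_of_lt hfatou (lt_of_le_of_lt (liminf_le_of_le (a := ENNReal.ofReal C)
    (by isBoundedDefault) fun b hb => ?_) ENNReal.ofReal_lt_top)
  obtain ⟨N, hN⟩ := hb.exists
  refine hN.trans ?_
  rw [← ofReal_integral_eq_lintegral_ofReal]
  · exact ENNReal.ofReal_le_ofReal (hbd N)
  · refine Integrable.of_bound (C := N) (Measurable.aestronglyMeasurable (by fun_prop))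
      (Eventually.of_forall fun x => ?_)
    rw [Real.norm_of_nonneg (by positivity)]
    exact min_le_right _ _
  · exact Eventually.of_forall fun x => by positivity

/-- `X 0, X 1, …` are iid with regularly varying tail of index `α`. -/
structure HeavyIID {Ω : Type*} [MeasurableSpace Ω] (P : Measure Ω) (X : ℕ → Ω → ℝ) (α : ℝ) :
    Prop where
  measurable : ∀ j, Measurable (X j)
  indep : iIndepFun X P
  ident : ∀ j, IdentDistrib (X j) (X 0) P P
  tail : RegularlyVaryingTail P (X 0) α

/-! ### The limit theorem for a deterministic diagonal -/

section

variable {Ω : Type*} [MeasurableSpace Ω] {P : Measure Ω}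
  {X : ℕ → Ω → ℝ} {α : ℝ} {a : (n : ℕ) → Fin n → ℝ} {ν : Measure ℝ}

theorem measurable_sqForm_rows (hX : HeavyIID P X α) (a : (n : ℕ) → Fin n → ℝ) (n : ℕ) :
    Measurable fun ω => sqForm (selfNormalizedVector X n ω) (a n) :=
  measurable_sqForm_selfNormalizedVector hX.measurable _

/-- The same convex combination of nearest points of the `b i` lies in `K` and serves as a
competitor. -/
theorem infDist_sum_le {n : ℕ} {K : Set ℝ} (hK : IsClosed K) (hne : K.Nonempty)
    (hconv : Convex ℝ K) {p b : Fin n → ℝ} (hp0 : ∀ i, 0 ≤ p i) (hp1 : ∑ i, p i = 1) :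
    Metric.infDist (∑ i, b i * p i) K ≤ ∑ i, Metric.infDist (b i) K * p i := by
  choose k hk hkd using fun i => hK.exists_infDist_eq_dist hne (b i)
  have hmem : ∑ i, p i • k i ∈ K := hconv.sum_mem (fun i _ => hp0 i) hp1 fun i _ => hk i
  refine (Metric.infDist_le_dist_of_mem hmem).trans ?_
  rw [Real.dist_eq, ← Finset.sum_sub_distrib]
  refine (Finset.abs_sum_le_sum_abs _ _).trans (Finset.sum_le_sum fun i _ => le_of_eq ?_)
  rw [hkd, Real.dist_eq, smul_eq_mul, mul_comm (p i), ← sub_mul, abs_mul, abs_of_nonneg (hp0 i)]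

theorem tendsto_avg_infDist (ha : WeakAvg a ν) (hUI : UnifTail a) {K : Set ℝ}
    (hne : K.Nonempty) (hνK : ∀ᵐ x ∂ν, x ∈ K) :
    Tendsto (fun n : ℕ => (n : ℝ)⁻¹ * ∑ i, Metric.infDist (a n i) K) atTop (𝓝 0) := by
  obtain ⟨k₀, hk₀⟩ := hne
  rw [Metric.tendsto_nhds]
  intro ε hε
  obtain ⟨T, hT, hT0⟩ := ((hUI (ε / 2) (by positivity)).and (eventually_ge_atTop 0)).exists
  -- If `|x| ≤ T` the distance to `K` is at most `B`, so truncation at `B` loses nothing there; for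
  -- `|x| > T` the loss is at most `|x|`, which the tail average controls.
  set B : ℝ := T + |k₀| with hB
  have hB0 : 0 ≤ B := by positivity
  have hg := ha (fun x => min (Metric.infDist x K) B)
    ((Metric.continuous_infDist_pt K).min continuous_const) ⟨B, fun x => by
      rw [abs_of_nonneg (le_min Metric.infDist_nonneg hB0)]
      exact min_le_right _ _⟩
  have h0 : ∫ x, min (Metric.infDist x K) B ∂ν = 0 := by
    rw [integral_eq_zero_of_ae]
    filter_upwards [hνK] with x hx
    simp [Metric.infDist_zero_of_mem hx, hB0]
  rw [h0] at hg
  filter_upwards [hT, hg.eventually (gt_mem_nhds (half_pos hε))] with n h1 h2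
  rw [Real.dist_eq, sub_zero, abs_of_nonneg
    (mul_nonneg (by positivity) (Finset.sum_nonneg fun i _ => Metric.infDist_nonneg))]
  have hpt : ∀ x : ℝ, Metric.infDist x K ≤ min (Metric.infDist x K) B +
      Set.indicator {x : ℝ | T < |x|} (fun x => |x|) x := by
    intro x
    have hd : Metric.infDist x K ≤ |x| + |k₀| := by
      refine (Metric.infDist_le_dist_of_mem hk₀).trans ?_
      rw [Real.dist_eq]
      exact abs_sub _ _
    by_cases h : T < |x|
    · rw [Set.indicator_of_mem (by exact h)]
      rcases le_total (Metric.infDist x K) B with h' | h'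
      · rw [min_eq_left h']
        linarith [abs_nonneg x]
      · rw [min_eq_right h']
        linarith
    · rw [Set.indicator_of_notMem (by exact h), min_eq_left (by linarith [not_lt.1 h])]
      linarith
  have h3 := avg_mono (n := n) fun i => hpt (a n i)
  rw [Finset.sum_add_distrib, mul_add] at h3
  unfold tailAverage at h1
  linarith

variable [IsProbabilityMeasure P]

/-- The expected distance of the form from `K`, truncated at `1`, is at most the average distance of
the `a n i` plus the probability that all `X i` vanish. The latter is needed because the form then
equals `0`, which may lie outside `K`. -/
theorem ae_mem_of_tendsto_law (hX : HeavyIID P X α) (ha : WeakAvg a ν) (hUI : UnifTail a)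
    {K : Set ℝ} (hK : IsClosed K) (hne : K.Nonempty) (hconv : Convex ℝ K)
    (hνK : ∀ᵐ x ∂ν, x ∈ K) {μ : ProbabilityMeasure ℝ}
    (hμ : Tendsto (fun n => law P (measurable_sqForm_rows hX a n)) atTop (𝓝 μ)) :
    ∀ᵐ x ∂(μ : Measure ℝ), x ∈ K := by
  set g : ℝ → ℝ := fun x => min (Metric.infDist x K) 1 with hg
  have hgc : Continuous g := (Metric.continuous_infDist_pt K).min continuous_const
  have hg0 : ∀ x, 0 ≤ g x := fun x => le_min Metric.infDist_nonneg zero_le_one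
  have hg1 : ∀ x, ‖g x‖ ≤ 1 := fun x => by
    rw [Real.norm_of_nonneg (hg0 x)]
    exact min_le_right _ _
  have h1 := tendsto_integral_of_tendsto_law (κ := id) (measurable_sqForm_rows hX a) hμ hgc hg1
  have hpos : 0 < P.real {ω | 1 < X 0 ω ^ 2} := (regVar_sq hX.tail).1 1 one_pos
  have h2 := (tendsto_avg_infDist ha hUI hne hνK).add
    (tendsto_measureReal_sum_sq_eq_zero hX.measurable hX.indep hX.ident hpos)
  rw [add_zero] at h2
  have hle : ∀ n, ∫ ω, g (sqForm (selfNormalizedVector X n ω) (a n)) ∂P ≤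
      (n : ℝ)⁻¹ * ∑ i, Metric.infDist (a n i) K +
        P.real {ω | ∑ i : Fin n, X i ω ^ 2 = 0} := by
    intro n
    have hms : MeasurableSet {ω | ∑ i : Fin n, X i ω ^ 2 = 0} :=
      (Finset.measurable_sum Finset.univ fun (i : Fin n) _ => (hX.measurable i).pow_const 2)
        (measurableSet_singleton 0)
    have hpt : ∀ ω, g (sqForm (selfNormalizedVector X n ω) (a n)) ≤
        sqForm (selfNormalizedVector X n ω) (fun i => Metric.infDist (a n i) K) +
          Set.indicator {ω | ∑ i : Fin n, X i ω ^ 2 = 0} 1 ω := by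
      intro ω
      have hnn : 0 ≤ sqForm (selfNormalizedVector X n ω) (fun i => Metric.infDist (a n i) K) :=
        Finset.sum_nonneg fun i _ => mul_nonneg Metric.infDist_nonneg (sq_nonneg _)
      by_cases hω : ω ∈ {ω | ∑ i : Fin n, X i ω ^ 2 = 0}
      · rw [Set.indicator_of_mem hω]
        have : g (sqForm (selfNormalizedVector X n ω) (a n)) ≤ 1 := min_le_right _ _
        simp only [Pi.one_apply]
        linarith
      · rw [Set.indicator_of_notMem hω, add_zero]
        refine (min_le_left _ _).trans ?_
        exact infDist_sum_le hK hne hconv (fun i => sq_nonneg _)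
          (sum_selfNormalize_sq_eq_one (x := fun i : Fin n => X i ω) hω)
    have hI1 : Integrable (fun ω => sqForm (selfNormalizedVector X n ω)
      (fun i => Metric.infDist (a n i) K)) P := integrable_sqForm hX.measurable _
    have hI2 : Integrable (Set.indicator {ω | ∑ i : Fin n, X i ω ^ 2 = 0} (1 : Ω → ℝ)) P :=
      (integrable_const 1).indicator hms
    have h3 := integral_mono (μ := P) (Integrable.of_bound (C := 1)
      (hgc.measurable.comp (measurable_sqForm_rows hX a n)).aestronglyMeasurable
      (Eventually.of_forall fun ω => hg1 _)) (hI1.add hI2) hpt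
    refine h3.trans ?_
    simp only [Pi.add_apply]
    rw [integral_add hI1 hI2, integral_indicator_one hms]
    gcongr
    exact integral_sqForm_le hX.measurable hX.indep hX.ident fun i => Metric.infDist_nonneg
  have h3 : ∫ x, g x ∂(μ : Measure ℝ) = 0 := tendsto_nhds_unique h1
    (squeeze_zero (fun n => integral_nonneg fun ω => hg0 _) hle h2)
  have hgi : Integrable g (μ : Measure ℝ) := Integrable.of_bound (C := 1)
    hgc.aestronglyMeasurable (Eventually.of_forall hg1)
  have h4 := (integral_eq_zero_iff_of_nonneg hg0 hgi).1 h3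
  filter_upwards [h4] with x hx
  have hx : min (Metric.infDist x K) 1 = 0 := hx
  have h5 : Metric.infDist x K = 0 := by
    rcases min_choice (Metric.infDist x K) 1 with h | h
    · rwa [h] at hx
    · rw [h] at hx
      exact absurd hx one_ne_zero
  exact (hK.mem_iff_infDist_zero hne).2 h5

variable [IsProbabilityMeasure ν]

theorem tendsto_integral_log_sub_sqForm (hX : HeavyIID P X α) (hα0 : 0 < α) (hα2 : α < 2)
    (ha : WeakAvg a ν) {T z : ℝ} (hT : 0 ≤ T) (hz : T < z) :
    Tendsto (fun n => ∫ ω, Real.log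
      (z - sqForm (selfNormalizedVector X n ω) fun i => clip T (a n i)) ∂P) atTop
      (𝓝 ((α / 2)⁻¹ * Real.log (∫ x, (z - clip T x) ^ (α / 2) ∂ν))) := by
  have hbd : ∀ n ω, |sqForm (selfNormalizedVector X n ω) fun i => clip T (a n i)| ≤ T :=
    fun n ω => abs_sqForm_selfNormalize_le _ _ hT fun i => abs_clip_le hT _
  refine tendsto_integral_log_ratio (V := fun j ω => X j ω ^ 2)
    (fun j => (hX.measurable j).pow_const 2)
    (hX.indep.comp (fun _ x => x ^ 2) fun _ => by fun_prop)
    (fun j => (hX.ident j).comp (u := fun x => x ^ 2) (by fun_prop))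
    (fun j ω => sq_nonneg _) (by linarith) (by linarith) (regVar_sq hX.tail) ha
    (h := fun x => z - clip T x) (continuous_const.sub (continuous_clip T))
    (m := z - T) (M := z + T) (by linarith) (fun x => by linarith [clip_le hT x])
    (fun x => by linarith [neg_le_clip T x])
    (fun n => measurable_const.sub (measurable_sqForm_selfNormalizedVector hX.measurable _))
    (fun n ω => by linarith [(abs_le.1 (hbd n ω)).2])
    (fun n ω => by linarith [(abs_le.1 (hbd n ω)).1]) fun n ω => ?_
  simp only [sub_mul, Finset.sum_sub_distrib, ← Finset.mul_sum]
  congr 1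
  rw [sqForm, Finset.sum_mul]
  refine Finset.sum_congr rfl fun i _ => ?_
  rw [mul_assoc]
  congr 1
  exact selfNormalize_sq_mul_sum (fun i : Fin n => X i ω) i

theorem integral_clip_cpow_ne_zero {β T : ℝ} (hβ0 : 0 < β) (hβ1 : β < 1) (hT : 0 ≤ T) {w : ℂ}
    (hw : w.im ≠ 0) : ∫ x, (w - (clip T x : ℝ)) ^ (β : ℂ) ∂ν ≠ 0 := by
  have hm : Measurable (clip T) := (continuous_clip T).measurable
  have : IsProbabilityMeasure (ν.map (clip T)) :=
    Measure.isProbabilityMeasure_map hm.aemeasurable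
  have hint : Integrable (fun x : ℝ => |x|) (ν.map (clip T)) := by
    rw [integrable_map_measure (by fun_prop) hm.aemeasurable]
    exact Integrable.of_bound (C := T) (Measurable.aestronglyMeasurable (by fun_prop))
      (Eventually.of_forall fun x => by simpa using abs_clip_le hT x)
  have := powerIntegral_ne_zero hint hβ0 hβ1 (notMem_supportHull_of_im_ne_zero hw)
  rwa [powerIntegral, integral_map hm.aemeasurable (measurable_sub_cpow w β).aestronglyMeasurable]
    at this

theorem tendsto_cauchy_clip (hX : HeavyIID P X α) (hα0 : 0 < α) (hα2 : α < 2)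
    (ha : WeakAvg a ν) {T : ℝ} (hT : 0 ≤ T) {w : ℂ} (hw : w.im ≠ 0) :
    Tendsto (fun n => ∫ ω,
      (w - (sqForm (selfNormalizedVector X n ω) (fun i => clip T (a n i)) : ℝ))⁻¹ ∂P) atTop
      (𝓝 ((∫ x, (w - (clip T x : ℝ)) ^ ((α / 2 - 1 : ℝ) : ℂ) ∂ν) /
        ∫ x, (w - (clip T x : ℝ)) ^ ((α / 2 : ℝ) : ℂ) ∂ν)) := by
  set Y : ℕ → Ω → ℝ := fun n ω => sqForm (selfNormalizedVector X n ω) fun i => clip T (a n i)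
    with hYdef
  have hY : ∀ n, Measurable (Y n) := fun n =>
    measurable_sqForm_rows hX (fun n i => clip T (a n i)) n
  have hbd : ∀ n ω, |Y n ω| ≤ T :=
    fun n ω => abs_sqForm_selfNormalize_le _ _ hT fun i => abs_clip_le hT _
  have hint : ∀ n, Integrable (Y n) P := fun n => integrable_sqForm hX.measurable _
  have hC : ∀ᶠ n in atTop, ∫ ω, |Y n ω| ∂P ≤ T := Eventually.of_forall fun n => by
    have := integral_mono (hint n).abs (integrable_const T) (hbd n)
    simpa using this
  -- The limit law is not yet known to live in `[-T, T]`. Testing against functions of `clip T x`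
  -- makes them bounded and continuous on the whole line without changing their values along the
  -- sequence.
  have hclip : ∀ n ω, clip T (Y n ω) = Y n ω := fun n ω => clip_eq_self (hbd n ω)
  have hcc := continuous_clip T
  refine tendsto_of_subseq_tendsto fun ns hns => ?_
  obtain ⟨μ, ms, hms, hμ⟩ := exists_subseq_tendsto_law hY hint hC ns
  refine ⟨ms, ?_⟩
  have hlog : ∀ z : ℝ, T < z → ∫ x, Real.log (z - clip T x) ∂(μ : Measure ℝ) =
      (α / 2)⁻¹ * Real.log (∫ x, (z - clip T x) ^ (α / 2) ∂ν) := by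
    intro z hz
    have hpos : ∀ x, z - T ≤ z - clip T x := fun x => by linarith [clip_le hT x]
    have h1 := tendsto_integral_of_tendsto_law hY hμ (g := fun x => Real.log (z - clip T x))
      (Continuous.log (by fun_prop) fun x => ne_of_gt (by linarith [hpos x]))
      (C := |Real.log (z - T)| + |Real.log (z + T)|) fun x =>
        abs_log_le_of_mem (by linarith) (hpos x) (by linarith [neg_le_clip T x])
    simp only [hclip] at h1
    exact tendsto_nhds_unique h1 ((tendsto_integral_log_sub_sqForm hX hα0 hα2 ha hT hz).comp
      (hns.comp hms.tendsto_atTop))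
  have hid := cauchy_transform_clip_of_log (by linarith) hT hlog
    (sub_ofReal_mem_slitPlane_of_im_ne_zero hw T)
  have hne := integral_clip_cpow_ne_zero (ν := ν) (β := α / 2) (by linarith) (by linarith) hT hw
  rw [← eq_div_iff hne] at hid
  rw [← hid]
  have h2 := tendsto_integral_of_tendsto_law hY hμ (g := fun x => (w - (clip T x : ℝ))⁻¹)
    ((continuous_inv_sub hw).comp hcc) fun x => norm_inv_sub_le hw _
  simpa only [hclip] using h2

theorem integral_abs_sqForm_sub_clip_le (hX : HeavyIID P X α) (a : (n : ℕ) → Fin n → ℝ) {T : ℝ}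
    (hT : 0 ≤ T) (n : ℕ) :
    ∫ ω, |sqForm (selfNormalizedVector X n ω) (a n) -
      sqForm (selfNormalizedVector X n ω) fun i => clip T (a n i)| ∂P ≤ tailAverage (a n) T := by
  have h1 : ∀ ω, |sqForm (selfNormalizedVector X n ω) (a n) -
      sqForm (selfNormalizedVector X n ω) fun i => clip T (a n i)| ≤
      sqForm (selfNormalizedVector X n ω) fun i => |a n i - clip T (a n i)| := fun ω => by
    rw [sqForm_sub]
    exact abs_sqForm_le _ _
  refine (integral_mono ((integrable_sqForm hX.measurable _).sub
    (integrable_sqForm hX.measurable _)).abs (integrable_sqForm hX.measurable _) h1).trans ?_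
  refine (integral_sqForm_le hX.measurable hX.indep hX.ident fun i => abs_nonneg _).trans ?_
  exact avg_mono fun i => abs_sub_clip_le hT _

theorem norm_integral_inv_sub_sub_le {Y Z : Ω → ℝ} (hY : Measurable Y) (hZ : Measurable Z)
    (hYZ : Integrable (fun ω => Y ω - Z ω) P) {w : ℂ} (hw : w.im ≠ 0) :
    ‖(∫ ω, (w - (Y ω : ℂ))⁻¹ ∂P) - ∫ ω, (w - (Z ω : ℂ))⁻¹ ∂P‖ ≤
      (|w.im|⁻¹ * |w.im|⁻¹) * ∫ ω, |Y ω - Z ω| ∂P := by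
  have hi : ∀ {U : Ω → ℝ}, Measurable U → Integrable (fun ω => (w - (U ω : ℂ))⁻¹) P := fun hU =>
    Integrable.of_bound (C := |w.im|⁻¹) (((continuous_inv_sub hw).measurable.comp
      hU).aestronglyMeasurable) (Eventually.of_forall fun ω => norm_inv_sub_le hw _)
  rw [← integral_sub (hi hY) (hi hZ), ← integral_const_mul]
  refine norm_integral_le_of_norm_le (hYZ.abs.const_mul _) (Eventually.of_forall fun ω => ?_)
  have hne : ∀ x : ℝ, w - (x : ℂ) ≠ 0 := fun x =>
    Complex.slitPlane_ne_zero (sub_ofReal_mem_slitPlane_of_im_ne_zero hw x)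
  have e : (w - (Y ω : ℂ))⁻¹ - (w - (Z ω : ℂ))⁻¹ =
      (w - (Y ω : ℂ))⁻¹ * (w - (Z ω : ℂ))⁻¹ * ((Y ω - Z ω : ℝ) : ℂ) := by
    have h1 := hne (Y ω)
    have h2 := hne (Z ω)
    push_cast
    field_simp
    ring
  rw [e, norm_mul, norm_mul, Complex.norm_real, Real.norm_eq_abs]
  have h1 := norm_inv_sub_le hw (Y ω)
  have h2 := norm_inv_sub_le hw (Z ω)
  gcongr

/-- An `ε / 3` argument with `T` chosen before `n`: the Cauchy kernel is Lipschitz with constant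
`|w.im|⁻¹ ^ 2`, so clipping costs that times the tail average; the clipped transforms converge in
`n`; and the clipped formula converges as `T` grows. -/
theorem tendsto_cauchy (hX : HeavyIID P X α) (hα0 : 0 < α) (hα2 : α < 2)
    (ha : WeakAvg a ν) (hUI : UnifTail a) {w : ℂ} (hw : w.im ≠ 0) :
    Tendsto (fun n => ∫ ω, (w - (sqForm (selfNormalizedVector X n ω) (a n) : ℝ))⁻¹ ∂P) atTop
      (𝓝 (powerIntegral ν (α / 2 - 1) w / powerIntegral ν (α / 2) w)) := by
  have hν := integrable_abs_of_unifTail ha hUI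
  have hη : 0 < |w.im|⁻¹ * |w.im|⁻¹ := by
    have := abs_pos.2 hw
    positivity
  have hratio := (tendsto_integral_cpow_clip_neg (ν := ν) (β := α / 2) (by linarith) hw).div
    (tendsto_integral_cpow_clip_pos hν (β := α / 2) (by linarith) (by linarith) hw)
    (powerIntegral_ne_zero hν (by linarith) (by linarith) (notMem_supportHull_of_im_ne_zero hw))
  rw [Metric.tendsto_nhds]
  intro ε hε
  have hT : ∀ᶠ T : ℕ in atTop, ∀ᶠ n in atTop, tailAverage (a n) T <
      ε / 3 / (|w.im|⁻¹ * |w.im|⁻¹) :=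
    tendsto_natCast_atTop_atTop.eventually (hUI _ (by positivity))
  obtain ⟨T, hT1, hT2⟩ := (hT.and (Metric.tendsto_nhds.1 hratio (ε / 3) (by positivity))).exists
  have h3 := Metric.tendsto_nhds.1 (tendsto_cauchy_clip hX hα0 hα2 ha (Nat.cast_nonneg (α := ℝ) T)
    hw) (ε / 3) (by positivity)
  filter_upwards [hT1, h3] with n h4 h5
  have h6 := norm_integral_inv_sub_sub_le (P := P)
    (measurable_sqForm_rows hX a n) (measurable_sqForm_rows hX (fun n i => clip (T : ℝ) (a n i)) n)
    ((integrable_sqForm hX.measurable _).sub (integrable_sqForm hX.measurable _)) hw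
  have h7 := integral_abs_sqForm_sub_clip_le hX a (Nat.cast_nonneg (α := ℝ) T) n
  rw [lt_div_iff₀ hη] at h4
  have h8 := h6.trans (mul_le_mul_of_nonneg_left h7 hη.le)
  rw [← dist_eq_norm] at h8
  simp only [Pi.div_apply] at hT2
  rw [mul_comm] at h4
  have h9 := add_lt_add (add_lt_add (h8.trans_lt h4) h5) hT2
  exact (dist_triangle4 _ _ _ _).trans_lt (h9.trans_eq (by ring))

/-- The limit theorem for a deterministic triangular array. -/
theorem exists_limit_law (hX : HeavyIID P X α) (hα0 : 0 < α) (hα2 : α < 2)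
    (ha : WeakAvg a ν) (hUI : UnifTail a) :
    ∃ μ : ProbabilityMeasure ℝ, HasLimitStieltjes α ν μ ∧
      (∀ᵐ x ∂(μ : Measure ℝ), x ∈ convexHull ℝ ν.support) ∧
      Tendsto (fun n => law P (measurable_sqForm_rows hX a n)) atTop (𝓝 μ) := by
  obtain ⟨C, hC⟩ := hUI.exists_avg_abs_le
  have hν := integrable_abs_of_unifTail ha hUI
  have hbd : ∀ᶠ n : ℕ in atTop, ∫ ω, |sqForm (selfNormalizedVector X n ω) (a n)| ∂P ≤ C := by
    filter_upwards [hC] with n hn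
    refine (integral_mono (integrable_sqForm hX.measurable _).abs
      (integrable_sqForm hX.measurable _) fun ω => abs_sqForm_le _ _).trans ?_
    exact (integral_sqForm_le hX.measurable hX.indep hX.ident fun i => abs_nonneg _).trans hn
  obtain ⟨μ, hμ, hS⟩ := exists_tendsto_law_of_cauchy (measurable_sqForm_rows hX a)
    (fun n => integrable_sqForm hX.measurable _) hbd
    fun w hw => tendsto_cauchy hX hα0 hα2 ha hUI hw
  have hKne : (convexHull ℝ ν.support).Nonempty :=
    (Measure.nonempty_support (IsProbabilityMeasure.ne_zero ν)).convexHull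
  have hK := ae_mem_of_tendsto_law hX ha hUI
    (isClosed_convexHull_of_isClosed (Measure.isClosed_support (μ := ν))) hKne
    (convex_convexHull ℝ _) (ae_mem_convexHull_support ν) hμ
  refine ⟨μ, hasLimitStieltjes_of_im_ne_zero hα0 hα2 hν hK fun z hz => ?_, hK, hμ⟩
  rw [stieltjesTransform_eq_neg, hS z hz]

end

/-! ### Random diagonals and the conclusion -/

theorem integral_empiricalMeasure {n : ℕ} (a : Fin n → ℝ) (f : ℝ → ℝ) :
    ∫ x, f x ∂(empiricalMeasure a : Measure ℝ) = (n : ℝ)⁻¹ * ∑ i, f (a i) := by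
  have h : (empiricalMeasure a : Measure ℝ) =
      (n : ℝ≥0)⁻¹ • ∑ i, Measure.dirac (a i) := by
    simp only [empiricalMeasure, FiniteMeasure.toMeasure_smul, FiniteMeasure.toMeasure_sum]
    rfl
  rw [h, integral_smul_nnreal_measure, integral_finsetSum_measure fun i _ =>
    integrable_dirac (by simp)]
  simp [NNReal.smul_def]

theorem weakAvg_of_tendsto {a : (n : ℕ) → Fin n → ℝ} {ν : ProbabilityMeasure ℝ}
    (h : Tendsto (fun n => empiricalMeasure (a n)) atTop (𝓝 ν.toFiniteMeasure)) :
    WeakAvg a (ν : Measure ℝ) := by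
  intro f hf ⟨C, hC⟩
  have := FiniteMeasure.tendsto_iff_forall_integral_tendsto.1 h
    (BoundedContinuousFunction.ofNormedAddCommGroup f hf C hC)
  simp only [BoundedContinuousFunction.coe_ofNormedAddCommGroup, integral_empiricalMeasure] at this
  exact this

theorem unifTail_of_tendsto {a : (n : ℕ) → Fin n → ℝ}
    (h : Tendsto (fun T : ℝ => limsup (fun n : ℕ => ENNReal.ofReal (tailAverage (a n) T)) atTop)
      atTop (𝓝 0)) : UnifTail a := by
  intro ε hε
  filter_upwards [h.eventually (gt_mem_nhds (ENNReal.ofReal_pos.2 hε))] with T hT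
  filter_upwards [eventually_lt_of_limsup_lt hT] with n hn
  exact (ENNReal.ofReal_lt_ofReal_iff hε).1 hn

theorem measurable_realDiag {n : ℕ} :
    Measurable (realDiag : Matrix (Fin n) (Fin n) ℂ → Fin n → ℝ) := by
  refine measurable_pi_lambda _ fun i => ?_
  have h1 : Measurable fun A : Fin n → Fin n → ℂ => A i i :=
    (measurable_pi_apply i).comp (measurable_pi_apply i)
  exact Complex.measurable_re.comp h1

/-- Fubini for the product law of the diagonal and the vector: this is conditioning on the matrix.
Measurability of the inner integral is recorded for the dominated convergence that follows. -/
theorem integral_sqForm_of_indepFun {Ω : Type*} [MeasurableSpace Ω] {P : Measure Ω}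
    [IsProbabilityMeasure P] {n : ℕ} {y : Ω → Fin n → ℝ} {A : Ω → Matrix (Fin n) (Fin n) ℂ}
    (hy : Measurable y) (hA : Measurable A) (hind : IndepFun A y P)
    (f : BoundedContinuousFunction ℝ ℝ) :
    AEStronglyMeasurable (fun ω => ∫ ω', f (sqForm (y ω') (realDiag (A ω))) ∂P) P ∧
    ∫ ω, f (sqForm (y ω) (realDiag (A ω))) ∂P =
      ∫ ω, (∫ ω', f (sqForm (y ω') (realDiag (A ω))) ∂P) ∂P := by
  have hF : Measurable fun p : (Fin n → ℝ) × (Fin n → ℝ) => f (sqForm p.2 p.1) :=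
    f.continuous.measurable.comp (measurable_sqForm.comp measurable_swap)
  have hD : Measurable fun ω => realDiag (A ω) := measurable_realDiag.comp hA
  have hind' : IndepFun (fun ω => realDiag (A ω)) y P :=
    hind.comp measurable_realDiag measurable_id
  have hprob : IsProbabilityMeasure (P.map fun ω => realDiag (A ω)) :=
    Measure.isProbabilityMeasure_map hD.aemeasurable
  have hprob' : IsProbabilityMeasure (P.map y) := Measure.isProbabilityMeasure_map hy.aemeasurable
  have hinner : ∀ b : Fin n → ℝ, ∫ v, f (sqForm v b) ∂(P.map y) = ∫ ω', f (sqForm (y ω') b) ∂P :=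
    fun b => integral_map hy.aemeasurable
      (hF.comp (measurable_const.prodMk measurable_id)).aestronglyMeasurable
  have hsm : StronglyMeasurable fun b : Fin n → ℝ => ∫ v, f (sqForm v b) ∂(P.map y) :=
    StronglyMeasurable.integral_prod_right (f := fun b v => f (sqForm v b)) hF.stronglyMeasurable
  constructor
  · simp only [← hinner]
    exact (hsm.comp_measurable hD).aestronglyMeasurable
  · have h1 : ∫ ω, f (sqForm (y ω) (realDiag (A ω))) ∂P =
        ∫ p, f (sqForm p.2 p.1) ∂(P.map fun ω => (realDiag (A ω), y ω)) :=
      (integral_map (hD.prodMk hy).aemeasurable hF.aestronglyMeasurable).symm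
    rw [h1, (indepFun_iff_map_prod_eq_prod_map_map hD.aemeasurable hy.aemeasurable).1 hind',
      integral_prod]
    · simp only [hinner]
      rw [integral_map hD.aemeasurable]
      simp only [← hinner]
      exact hsm.aestronglyMeasurable
    · exact Integrable.of_bound (C := ‖f‖) hF.aestronglyMeasurable
        (Eventually.of_forall fun p => f.norm_coe_le_norm _)

end HeavyQuad

theorem mainTheorem3 {Ω : Type*} [MeasurableSpace Ω] (P : Measure Ω) [IsProbabilityMeasure P]
    (α : ℝ) (hα0 : 0 < α) (hα2 : α < 2)
    -- `X 0, X 1, …` are iid, symmetric, and regularly varying with index `α`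
    (X : ℕ → Ω → ℝ) (hXm : ∀ j, Measurable (X j)) (hXindep : iIndepFun X P)
    (hXid : ∀ j, IdentDistrib (X j) (X 0) P P)
    (hXsymm : IdentDistrib (X 0) (fun ω => -X 0 ω) P P)
    (hXtail : HeavyQuad.RegularlyVaryingTail P (X 0) α)
    -- random Hermitian `n × n` matrices, independent of the self-normalized vector
    (A : (n : ℕ) → Ω → Matrix (Fin n) (Fin n) ℂ) (hAm : ∀ n, Measurable (A n))
    (hAherm : ∀ n ω, (A n ω).IsHermitian)
    (hAindep : ∀ n, IndepFun (A n) (HeavyQuad.selfNormalizedVector X n) P)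
    -- the empirical measure of the diagonal converges weakly to `ν`, almost surely
    (ν : ProbabilityMeasure ℝ)
    (hν : ∀ᵐ ω ∂P, Tendsto
      (fun n : ℕ => HeavyQuad.empiricalMeasure (HeavyQuad.realDiag (A n ω))) atTop
      (𝓝 ν.toFiniteMeasure))
    -- uniform integrability of the diagonal, almost surely
    (hUI : ∀ᵐ ω ∂P, Tendsto
      (fun T : ℝ => limsup (fun n : ℕ =>
        ENNReal.ofReal (HeavyQuad.tailAverage (HeavyQuad.realDiag (A n ω)) T)) atTop) atTop
      (𝓝 (0 : ℝ≥0∞))) :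
    -- the integrals in the formula for the Stieltjes transform exist, and one may divide
    (∀ z : ℂ, z ∉ HeavyQuad.supportHull ν →
      Integrable (fun x : ℝ => (z - (x : ℂ)) ^ ((α / 2 - 1 : ℝ) : ℂ)) (ν : Measure ℝ) ∧
      Integrable (fun x : ℝ => (z - (x : ℂ)) ^ ((α / 2 : ℝ) : ℂ)) (ν : Measure ℝ) ∧
      HeavyQuad.powerIntegral ν (α / 2) z ≠ 0) ∧
    -- there is exactly one probability measure with this Stieltjes transform; it is the limit law
    ∃ μ : ProbabilityMeasure ℝ,
      HeavyQuad.HasLimitStieltjes α ν μ ∧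
      (∀ μ' : ProbabilityMeasure ℝ, HeavyQuad.HasLimitStieltjes α ν μ' → μ' = μ) ∧
      (μ : Measure ℝ).support ⊆ convexHull ℝ (ν : Measure ℝ).support ∧
      TendstoInDistribution
        (fun (n : ℕ) (ω : Ω) =>
          HeavyQuad.diagQuadForm (HeavyQuad.selfNormalizedVector X n ω) (A n ω))
        atTop (id : ℝ → ℝ) (fun _ => P) (μ : Measure ℝ) := by
  have hX : HeavyQuad.HeavyIID P X α := ⟨hXm, hXindep, hXid, hXtail⟩
  have hgood : ∀ᵐ ω ∂P, HeavyQuad.WeakAvg (fun n => HeavyQuad.realDiag (A n ω)) (ν : Measure ℝ) ∧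
      HeavyQuad.UnifTail (fun n => HeavyQuad.realDiag (A n ω)) := by
    filter_upwards [hν, hUI] with ω h1 h2
    exact ⟨HeavyQuad.weakAvg_of_tendsto h1, HeavyQuad.unifTail_of_tendsto h2⟩
  -- A single good realization already produces the limit law, since `ν` does not depend on the
  -- sample point.
  obtain ⟨ω₀, hw₀, hU₀⟩ := hgood.exists
  have habs := HeavyQuad.integrable_abs_of_unifTail hw₀ hU₀
  have huniq : ∀ μ μ' : ProbabilityMeasure ℝ, HeavyQuad.HasLimitStieltjes α ν μ →
      HeavyQuad.HasLimitStieltjes α ν μ' → μ' = μ := by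
    intro μ μ' h h'
    have heq : (μ' : Measure ℝ) = μ := HeavyQuad.eq_of_stieltjesTransform_eq fun z hz => by
      have hz' := HeavyQuad.notMem_supportHull_of_im_ne_zero (ν := (ν : Measure ℝ)) hz.ne'
      rw [h' z hz', h z hz']
    exact Subtype.ext heq
  refine ⟨fun z hz => ⟨HeavyQuad.integrable_sub_cpow_neg (by linarith) hz,
    HeavyQuad.integrable_sub_cpow_pos habs (by linarith) (by linarith) z,
    HeavyQuad.powerIntegral_ne_zero habs (by linarith) (by linarith) hz⟩, ?_⟩
  obtain ⟨μ, hμS, hμK, -⟩ := HeavyQuad.exists_limit_law hX hα0 hα2 hw₀ hU₀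
  refine ⟨μ, hμS, fun μ' h' => huniq μ μ' hμS h', ?_, ?_⟩
  · exact Measure.support_subset_of_isClosed
      (HeavyQuad.isClosed_convexHull_of_isClosed Measure.isClosed_support) hμK
  · have hym := HeavyQuad.measurable_selfNormalizedVector hXm
    have hQm : ∀ n, Measurable fun ω =>
        HeavyQuad.diagQuadForm (HeavyQuad.selfNormalizedVector X n ω) (A n ω) := fun n => by
      simp only [HeavyQuad.diagQuadForm_eq_sqForm]
      exact HeavyQuad.measurable_sqForm.comp
        ((hym n).prodMk (HeavyQuad.measurable_realDiag.comp (hAm n)))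
    refine ⟨fun n => (hQm n).aemeasurable, aemeasurable_id, ?_⟩
    refine ProbabilityMeasure.tendsto_iff_forall_integral_tendsto.2 fun f => ?_
    have hint : ∀ n, ∫ x, f x ∂(P.map fun ω =>
        HeavyQuad.diagQuadForm (HeavyQuad.selfNormalizedVector X n ω) (A n ω)) =
        ∫ ω, (∫ ω', f (HeavyQuad.sqForm (HeavyQuad.selfNormalizedVector X n ω')
          (HeavyQuad.realDiag (A n ω))) ∂P) ∂P := fun n => by
      rw [integral_map (hQm n).aemeasurable f.continuous.aestronglyMeasurable]
      simp only [HeavyQuad.diagQuadForm_eq_sqForm]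
      exact (HeavyQuad.integral_sqForm_of_indepFun (hym n) (hAm n) (hAindep n) f).2
    have hlim : Tendsto (fun n => ∫ ω, (∫ ω', f (HeavyQuad.sqForm
        (HeavyQuad.selfNormalizedVector X n ω') (HeavyQuad.realDiag (A n ω))) ∂P) ∂P) atTop
        (𝓝 (∫ _ω, (∫ x, f x ∂(μ : Measure ℝ)) ∂P)) := by
      refine tendsto_integral_of_dominated_convergence (fun _ => ‖f‖)
        (fun n => (HeavyQuad.integral_sqForm_of_indepFun (hym n) (hAm n) (hAindep n) f).1)
        (integrable_const _) (fun n => Eventually.of_forall fun ω => ?_) ?_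
      · have := norm_integral_le_of_norm_le (μ := P) (integrable_const ‖f‖)
          (Eventually.of_forall fun ω' => f.norm_coe_le_norm (HeavyQuad.sqForm
            (HeavyQuad.selfNormalizedVector X n ω') (HeavyQuad.realDiag (A n ω))))
        simpa using this
      · filter_upwards [hgood] with ω hω
        -- Each good realization has its own limit law, but with the same Stieltjes transform, so
        -- uniqueness identifies it with `μ`. The inner integrals thus converge almost surely to a
        -- constant.
        obtain ⟨μ', hμ'S, -, hμ'⟩ := HeavyQuad.exists_limit_law hX hα0 hα2 hω.1 hω.2
        rw [huniq μ μ' hμS hμ'S] at hμ'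
        exact HeavyQuad.tendsto_integral_of_tendsto_law (κ := id)
          (HeavyQuad.measurable_sqForm_rows hX fun n => HeavyQuad.realDiag (A n ω)) hμ'
          f.continuous f.norm_coe_le_norm
    simp only [integral_const, probReal_univ, one_smul] at hlim
    simpa [hint] using hlim
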